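/- Consider the planar system \[ \dot x=-y,\qquad \dot y=g(x),\qquad g(x)=x(x+1)(x^2+\beta x+\alpha),\qquad \beta=-1,\ \alpha=\tfrac12, \] with Hamiltonian $H(x,y)=\frac{y^2}{2}+\int_0^x g(s)\,ds$. The origin is a center. Let $\mathcal P$ be its period annulus, that is, the largest punctured neighbourhood of the origin foliated by periodic orbits. The energies of the points of $\mathcal P$ fill an interval $(0,h_s)$ with $0<h_s<\infty$, for each $h\in(0,h_s)$ the points of $\mathcal P$ with $H=h$ form exactly one periodic orbit $\Gamma_h$, and the minimal positive period $T(h)$ of $\Gamma_h$ defines a differentiable function $T:(0,h_s)\to(0,\infty)$. The center has exactly two critical periods: there are exactly two $h\in(0,h_s)$ at which $T$ has a local maximum or a local minimum, and these are exactly the zeros of $T'$ in $(0,h_s)$. -/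

import Mathlib

noncomputable section

/-- A global solution `γ : ℝ → ℝ²` of the autonomous planar system `γ' = X(γ)`. -/
def IsSolution (X : ℝ × ℝ → ℝ × ℝ) (γ : ℝ → ℝ × ℝ) : Prop :=
  ∀ t : ℝ, HasDerivAt γ (X (γ t)) t

/-- `τ` is the minimal positive period of `γ`. -/
def IsMinimalPeriod (γ : ℝ → ℝ × ℝ) (τ : ℝ) : Prop :=
  IsLeast {s : ℝ | 0 < s ∧ Function.Periodic γ s} τ

/-- `Γ` is a periodic orbit of `X`: the trajectory of a nonconstant periodic solution. -/
def IsPeriodicOrbit (X : ℝ × ℝ → ℝ × ℝ) (Γ : Set (ℝ × ℝ)) : Prop :=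
  ∃ γ : ℝ → ℝ × ℝ, IsSolution X γ ∧ (∃ s : ℝ, 0 < s ∧ Function.Periodic γ s) ∧
    (∃ t : ℝ, γ t ≠ γ 0) ∧ Set.range γ = Γ

/-- `U` is a punctured (open, connected) neighbourhood of `p` which is foliated by periodic
orbits of `X`. -/
def IsPeriodicBand (X : ℝ × ℝ → ℝ × ℝ) (p : ℝ × ℝ) (U : Set (ℝ × ℝ)) : Prop :=
  p ∉ U ∧ IsOpen (insert p U) ∧ IsConnected (insert p U) ∧
    ∀ q ∈ U, ∃ Γ : Set (ℝ × ℝ), IsPeriodicOrbit X Γ ∧ q ∈ Γ ∧ Γ ⊆ U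

/-- `p` is a center: a singular point with a punctured neighbourhood foliated by periodic
orbits. -/
def IsCenter (X : ℝ × ℝ → ℝ × ℝ) (p : ℝ × ℝ) : Prop :=
  X p = 0 ∧ ∃ U : Set (ℝ × ℝ), IsPeriodicBand X p U

/-- The period annulus of `p`: the largest punctured neighbourhood of `p` foliated by periodic
orbits, i.e. the union of all such neighbourhoods (it is again one as soon as one exists). -/
def periodAnnulus (X : ℝ × ℝ → ℝ × ℝ) (p : ℝ × ℝ) : Set (ℝ × ℝ) :=
  ⋃₀ {U : Set (ℝ × ℝ) | IsPeriodicBand X p U}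

/-- The vector field of the potential system `x' = -y`, `y' = g(x)`. -/
def potentialField (g : ℝ → ℝ) (p : ℝ × ℝ) : ℝ × ℝ := (-p.2, g p.1)

/-- The Hamiltonian `H(x,y) = y²/2 + G(x)`, where `G(x) = ∫₀ˣ g(s) ds`. -/
def hamiltonian (g : ℝ → ℝ) (p : ℝ × ℝ) : ℝ := p.2 ^ 2 / 2 + ∫ s in (0 : ℝ)..p.1, g s

/-- `T`, on the interval `(0, hs)`, is the energy-period function of the center of the potential
system at the origin: the energies of the points of the period annulus fill exactly `(0, hs)`,
for every `h ∈ (0, hs)` the points of energy `h` in the annulus form one periodic orbit, and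
every motion along that orbit has minimal positive period `T h`.
This determines `hs` and the values of `T` on `(0, hs)`. -/
def IsPeriodFunction (g : ℝ → ℝ) (hs : ℝ) (T : ℝ → ℝ) : Prop :=
  hamiltonian g '' periodAnnulus (potentialField g) 0 = Set.Ioo 0 hs ∧
  ∀ h ∈ Set.Ioo 0 hs,
    IsPeriodicOrbit (potentialField g)
      {q | q ∈ periodAnnulus (potentialField g) 0 ∧ hamiltonian g q = h} ∧
    ∀ γ : ℝ → ℝ × ℝ, IsSolution (potentialField g) γ →
      γ 0 ∈ periodAnnulus (potentialField g) 0 → hamiltonian g (γ 0) = h →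
      IsMinimalPeriod γ (T h)

/-- The energies in `(0, hs)` of the critical periodic orbits: the points at which the period
function has a local maximum or a local minimum. -/
def criticalEnergies (hs : ℝ) (T : ℝ → ℝ) : Set ℝ :=
  {h | h ∈ Set.Ioo 0 hs ∧ IsLocalExtr T h}

/-- The quartic function `g(x) = x (x + 1) (x² + β x + α)`. -/
def hyperellipticPotential (α β : ℝ) (x : ℝ) : ℝ := x * (x + 1) * (x ^ 2 + β * x + α)

end

noncomputable section

open Set Filter Topology MeasureTheory

/-! Write `G(x) = x² P(x)` for the potential energy, `k = g(x)/x`, and use the coordinate `u = x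
√P(x)`, in which the energy is `y²/2 + u²`. On `x > -1` this coordinate is strictly increasing. With
`x(u)` its inverse and `h = r²`, the orbit is `u = r sin φ`, `y = -√2 r cos φ`, and its period is
`(1/√2) ∫ x'(r sin φ) dφ` over a full turn. Hence `√2 dT/dr = F₀(r)`, the integral over `(0, π)` of
`(x''(u) - x''(-u)) sin θ` with `u = r sin θ`. The theorem says that `F₀` has exactly two zeros and
changes sign at both.

At most two zeros: the Euler operator `D = r d/dr` passes under the integral and becomes `u d/du`,
so `(D - 2)(D - 5/2) F₀` is again a jump integral. Its integrand is positive for every `u`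
(`oddJump_periodOp_pos`): the values of the rational function `periodOp` at the two positions of
equal potential energy are separated by a constant or by an affine function of `u²`. Positivity
makes `(D - 2)F₀ / r^(5/2)` strictly increasing, so `F₀ / r²`, whose derivative has the sign of `(D
- 2)F₀`, is strictly quasiconvex (`div_sq_lt_max_of_euler_pos`).

At least two zeros: explicit bounds on `x''` give the signs `+, -, +` of `F₀` at `r = 1/100, 3/10,
9/20`, all below `√(13/60)`, the square root of the energy of the saddle `(-1, 0)`.

The dynamical part identifies the period annulus with the punctured interior of the homoclinic loop
at the saddle (`periodAnnulus_eq`) and the period function with `rootPeriod (√h)`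
(`isPeriodFunction_rootPeriod`). -/

/-- The cofactor `P` in `∫₀ˣ g = x² P(x)`. -/
def energyFactor (x : ℝ) : ℝ := x ^ 3 / 5 - x / 6 + 1 / 4

/-- The cofactor `k` in `g(x) = x k(x)`. -/
def forceFactor (x : ℝ) : ℝ := x ^ 3 - x / 2 + 1 / 2

/-- The numerator of the second derivative `x''(u)` of the inverse of `u = x √P(x)`,
over the denominator `k ^ 3`. -/
def periodDerivNum₀ (x : ℝ) : ℝ :=
  1/3 - 1/6 * x - 12/5 * x ^ 2 + 22/15 * x ^ 3 - 6/5 * x ^ 5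

/-- The numerator of `(u d/du) x''(u)` over the denominator `k ^ 5`. -/
def periodDerivNum₁ (x : ℝ) : ℝ :=
  5/24 * x - 64/45 * x ^ 2 - 13/90 * x ^ 3 + 3/2 * x ^ 4 + 2443/450 * x ^ 5 - 46/5 * x ^ 6
    + 46/15 * x ^ 7 + 198/25 * x ^ 8 - 116/25 * x ^ 9 + 48/25 * x ^ 11

/-- The numerator of `(u d/du)² x''(u)` over the denominator `k ^ 7`. -/
def periodDerivNum₂ (x : ℝ) : ℝ :=
  5/96 * x - 43/80 * x ^ 2 - 907/1080 * x ^ 3 + 143/180 * x ^ 4 + 10816/675 * x ^ 5 - 16747/675 * x ^ 6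
    + 7213/900 * x ^ 7 + 152/225 * x ^ 8 + 31363/1350 * x ^ 9 - 1858/75 * x ^ 10 - 31079/1125 * x ^ 11
    + 5752/125 * x ^ 12 - 5048/375 * x ^ 13 - 2724/125 * x ^ 14 + 1424/125 * x ^ 15 - 384/125 * x ^ 17

/-! ### Polynomial inequalities certified by positive Bernstein coefficients -/

/-- The constant `40/3` is the value of `periodOp` at `x = 0`, so the difference has a factor `x`.
This lemma and the next two say that `periodOp` lies below that value to the left of the origin and
above it on `(0, 3/5]`. -/
theorem opNum_lt_of_neg {x : ℝ} (h₁ : -1 < x) (h₂ : x < 0) :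
    0 < 40 / 3 * forceFactor x ^ 7 - (periodDerivNum₂ x - 9 / 2 * (periodDerivNum₁ x * forceFactor x ^ 2) +
      5 * (periodDerivNum₀ x * forceFactor x ^ 4)) := by
  obtain ⟨s, hs⟩ : ∃ s, s = x + 1 := ⟨_, rfl⟩
  obtain ⟨t, ht⟩ : ∃ t, t = -x := ⟨_, rfl⟩
  have hs0 : 0 < s := by linarith
  have ht0 : 0 < t := by linarith
  have hx : 0 < -x := by linarith
  -- Here `s + t` is the length of the interval, so the cofactor of `-x` can be homogenised in `s`
  -- and `t`. This is its Bernstein form on the interval, and all coefficients are positive. The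
  -- inequalities below are certified in the same way.
  have key : 40 / 3 * forceFactor x ^ 7 - (periodDerivNum₂ x - 9 / 2 * (periodDerivNum₁ x * forceFactor x ^ 2) +
      5 * (periodDerivNum₀ x * forceFactor x ^ 4)) =
      -x * (1/216000 * (
    8238750 * t ^ 20 + 146100500 * s ^ 1 * t ^ 19 + 1101825075 * s ^ 2 * t ^ 18 +
      4699702410 * s ^ 3 * t ^ 17 + 12821024047 * s ^ 4 * t ^ 16 + 24103741584 * s ^ 5 * t ^ 15 +
      32928525448 * s ^ 6 * t ^ 14 + 35453639552 * s ^ 7 * t ^ 13 + 34695021828 * s ^ 8 * t ^ 12 +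
      34781365624 * s ^ 9 * t ^ 11 + 33947631782 * s ^ 10 * t ^ 10 + 28337513700 * s ^ 11 * t ^ 9 +
      18770662110 * s ^ 12 * t ^ 8 + 9636189520 * s ^ 13 * t ^ 7 + 3818571600 * s ^ 14 * t ^ 6 +
      1166712400 * s ^ 15 * t ^ 5 + 272834150 * s ^ 16 * t ^ 4 + 47716500 * s ^ 17 * t ^ 3 +
      5911375 * s ^ 18 * t ^ 2 + 461250 * s ^ 19 * t ^ 1 + 16875 * s ^ 20)) := by
    rw [hs, ht]
    simp only [periodDerivNum₀, periodDerivNum₁, periodDerivNum₂, forceFactor]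
    ring
  rw [key]
  positivity

theorem lt_opNum_of_pos_left {x : ℝ} (h₁ : 0 < x) (h₂ : x ≤ 3/10) :
    0 < periodDerivNum₂ x - 9 / 2 * (periodDerivNum₁ x * forceFactor x ^ 2) +
      5 * (periodDerivNum₀ x * forceFactor x ^ 4) -
      40 / 3 * forceFactor x ^ 7 := by
  obtain ⟨s, hs⟩ : ∃ s, s = x := ⟨_, rfl⟩
  obtain ⟨t, ht⟩ : ∃ t, t = 3/10 - x := ⟨_, rfl⟩
  have hs0 : 0 < s := by linarith
  have ht0 : 0 ≤ t := by linarith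
  have hx : 0 < x := by linarith
  have key : periodDerivNum₂ x - 9 / 2 * (periodDerivNum₁ x * forceFactor x ^ 2) +
      5 * (periodDerivNum₀ x * forceFactor x ^ 4) -
      40 / 3 * forceFactor x ^ 7 =
      x * (40/10460353203 * (
    585937500000000000 * t ^ 20 + 10429687500000000000 * s ^ 1 * t ^ 19 +
      87941796875000000000 * s ^ 2 * t ^ 18 + 466555781250000000000 * s ^ 3 * t ^ 17 +
      1744107089062500000000 * s ^ 4 * t ^ 16 + 4874104734375000000000 * s ^ 5 * t ^ 15 +
      10539974615343750000000 * s ^ 6 * t ^ 14 + 18004638597120000000000 * s ^ 7 * t ^ 13 +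
      24581676239681250000000 * s ^ 8 * t ^ 12 + 26958670897779975000000 * s ^ 9 * t ^ 11 +
      23731622940822906000000 * s ^ 10 * t ^ 10 + 16661105085487107400000 * s ^ 11 * t ^ 9 +
      9209695573108949940000 * s ^ 12 * t ^ 8 + 3926591272989913428000 * s ^ 13 * t ^ 7 +
      1254646225799026530600 * s ^ 14 * t ^ 6 + 292443221994355785600 * s ^ 15 * t ^ 5 +
      52137790744592054736 * s ^ 16 * t ^ 4 + 9914817708400464444 * s ^ 17 * t ^ 3 +
      2522293508961201066 * s ^ 18 * t ^ 2 + 500866703543407344 * s ^ 19 * t ^ 1 +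
      44460457872974585 * s ^ 20)) := by
    rw [hs, ht]
    simp only [periodDerivNum₀, periodDerivNum₁, periodDerivNum₂, forceFactor]
    ring
  rw [key]
  positivity

theorem lt_opNum_of_pos_right {x : ℝ} (h₁ : 3/10 < x) (h₂ : x ≤ 3/5) :
    0 < periodDerivNum₂ x - 9 / 2 * (periodDerivNum₁ x * forceFactor x ^ 2) +
      5 * (periodDerivNum₀ x * forceFactor x ^ 4) -
      40 / 3 * forceFactor x ^ 7 := by
  obtain ⟨s, hs⟩ : ∃ s, s = x - 3/10 := ⟨_, rfl⟩
  obtain ⟨t, ht⟩ : ∃ t, t = 3/5 - x := ⟨_, rfl⟩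
  have hs0 : 0 < s := by linarith
  have ht0 : 0 ≤ t := by linarith
  have hx : 0 < x := by linarith
  have key : periodDerivNum₂ x - 9 / 2 * (periodDerivNum₁ x * forceFactor x ^ 2) +
      5 * (periodDerivNum₀ x * forceFactor x ^ 4) -
      40 / 3 * forceFactor x ^ 7 =
      x * (40/10460353203 * (
    44460457872974585 * t ^ 20 + 1277551611375576056 * s ^ 1 * t ^ 19 +
      17279306757772406594 * s ^ 2 * t ^ 18 + 143774299192040365836 * s ^ 3 * t ^ 17 +
      822533624587727414544 * s ^ 4 * t ^ 16 + 3444165831616642928640 * s ^ 5 * t ^ 15 +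
      10982264284742392313256 * s ^ 6 * t ^ 14 + 27383314362102484601664 * s ^ 7 * t ^ 13 +
      54356098757040191660736 * s ^ 8 * t ^ 12 + 86912957227887835417024 * s ^ 9 * t ^ 11 +
      112720080699623649109120 * s ^ 10 * t ^ 10 + 118904485027392165689152 * s ^ 11 * t ^ 9 +
      101895635579106584195328 * s ^ 12 * t ^ 8 + 70556148084759002637312 * s ^ 13 * t ^ 7 +
      39071462364706849834368 * s ^ 14 * t ^ 6 + 17016531533366499333120 * s ^ 15 * t ^ 5 +
      5679497425973764009728 * s ^ 16 * t ^ 4 + 1394853469811921482752 * s ^ 17 * t ^ 3 +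
      235660649699271546368 * s ^ 18 * t ^ 2 + 24156444291194580992 * s ^ 19 * t ^ 1 +
      1106679331600363520 * s ^ 20)) := by
    rw [hs, ht]
    simp only [periodDerivNum₀, periodDerivNum₁, periodDerivNum₂, forceFactor]
    ring
  rw [key]
  positivity

/-- Beyond `3/5` the separating value is `126 - 1500 u²` instead of `40/3`. Since `x² P(x) = u²` at
both positions of the same potential energy, the same number can be compared with `periodOp` on the
left and on the right. -/
theorem linear_lt_opNum {x : ℝ} (h₁ : 3/5 < x) (h₂ : x < 1) :
    0 < periodDerivNum₂ x - 9 / 2 * (periodDerivNum₁ x * forceFactor x ^ 2) +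
      5 * (periodDerivNum₀ x * forceFactor x ^ 4) -
      (126 - 1500 * (x ^ 2 * energyFactor x)) * forceFactor x ^ 7 := by
  obtain ⟨s, hs⟩ : ∃ s, s = x - 3/5 := ⟨_, rfl⟩
  obtain ⟨t, ht⟩ : ∃ t, t = 1 - x := ⟨_, rfl⟩
  have hs0 : 0 < s := by linarith
  have ht0 : 0 < t := by linarith
  have key : periodDerivNum₂ x - 9 / 2 * (periodDerivNum₁ x * forceFactor x ^ 2) +
      5 * (periodDerivNum₀ x * forceFactor x ^ 4) -
      (126 - 1500 * (x ^ 2 * energyFactor x)) * forceFactor x ^ 7 =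
      (25/57982058496 * (
    3633521648218121997 * t ^ 26 + 99412971262164365220 * s ^ 1 * t ^ 25 +
      1266053066301662678925 * s ^ 2 * t ^ 24 + 9942232869404497181500 * s ^ 3 * t ^ 23 +
      53623571252739829951250 * s ^ 4 * t ^ 22 + 208678583958307679758500 * s ^ 5 * t ^ 21 +
      596036380488851193496250 * s ^ 6 * t ^ 20 + 1237989166090982893982500 * s ^ 7 * t ^ 19 +
      1814691695684946831551875 * s ^ 8 * t ^ 18 + 2011659310140738576820000 * s ^ 9 * t ^ 17 +
      3813140521141438774446875 * s ^ 10 * t ^ 16 + 15829818158862429094375000 * s ^ 11 * t ^ 15 +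
      55418633090660989968437500 * s ^ 12 * t ^ 14 + 141162338204332654053125000 * s ^ 13 * t ^ 13 +
      274356646884916054554687500 * s ^ 14 * t ^ 12 +
      423156205010257080078125000 * s ^ 15 * t ^ 11 +
      529988843289762360888671875 * s ^ 16 * t ^ 10 + 545530224309704024414062500 * s ^ 17 * t ^ 9 +
      463508405541943797607421875 * s ^ 18 * t ^ 8 + 324534495725587182617187500 * s ^ 19 * t ^ 7 +
      185873122277250793457031250 * s ^ 20 * t ^ 6 + 85877547221936645507812500 * s ^ 21 * t ^ 5 +
      31290472723109436035156250 * s ^ 22 * t ^ 4 + 8671655020462036132812500 * s ^ 23 * t ^ 3 +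
      1720469734210968017578125 * s ^ 24 * t ^ 2 + 217968367767333984375000 * s ^ 25 * t ^ 1 +
      13265327930450439453125 * s ^ 26)) := by
    rw [hs, ht]
    simp only [periodDerivNum₀, periodDerivNum₁, periodDerivNum₂, energyFactor, forceFactor]
    ring
  rw [key]
  positivity

theorem opNum_lt_linear_left {x : ℝ} (h₁ : -1 < x) (h₂ : x ≤ -7/10) :
    0 < (126 - 1500 * (x ^ 2 * energyFactor x)) * forceFactor x ^ 7 -
      (periodDerivNum₂ x - 9 / 2 * (periodDerivNum₁ x * forceFactor x ^ 2) +
      5 * (periodDerivNum₀ x * forceFactor x ^ 4)) := by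
  obtain ⟨s, hs⟩ : ∃ s, s = x + 1 := ⟨_, rfl⟩
  obtain ⟨t, ht⟩ : ∃ t, t = -7/10 - x := ⟨_, rfl⟩
  have hs0 : 0 < s := by linarith
  have ht0 : 0 ≤ t := by linarith
  have key : (126 - 1500 * (x ^ 2 * energyFactor x)) * forceFactor x ^ 7 -
      (periodDerivNum₂ x - 9 / 2 * (periodDerivNum₁ x * forceFactor x ^ 2) +
      5 * (periodDerivNum₀ x * forceFactor x ^ 4)) =
      (100/22876792454961 * (
    343281250000000000000000000 * t ^ 26 + 8588896875000000000000000000 * s ^ 1 * t ^ 25 +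
      102818337781250000000000000000 * s ^ 2 * t ^ 24 +
      784139700670625000000000000000 * s ^ 3 * t ^ 23 +
      4279555088618550000000000000000 * s ^ 4 * t ^ 22 +
      17798449569327212500000000000000 * s ^ 5 * t ^ 21 +
      58648677208129606000000000000000 * s ^ 6 * t ^ 20 +
      157163970515983119318750000000000 * s ^ 7 * t ^ 19 +
      348822649192348483475000000000000 * s ^ 8 * t ^ 18 +
      649694184528388640579187500000000 * s ^ 9 * t ^ 17 +
      1025101994665864711903312500000000 * s ^ 10 * t ^ 16 +
      1379340498970178192385433750000000 * s ^ 11 * t ^ 15 +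
      1589793945576824417292397750000000 * s ^ 12 * t ^ 14 +
      1573474555494750222915297375000000 * s ^ 13 * t ^ 13 +
      1338297759951008010688844570000000 * s ^ 14 * t ^ 12 +
      977252827238498013707732862500000 * s ^ 15 * t ^ 11 +
      611007685126842326678463306900000 * s ^ 16 * t ^ 10 +
      325579480185440460767605797790000 * s ^ 17 * t ^ 9 +
      146838929748411124215974053360000 * s ^ 18 * t ^ 8 +
      55511530842790338132444840765000 * s ^ 19 * t ^ 7 +
      17356392581425608397253913245000 * s ^ 20 * t ^ 6 +
      4405437073174459668133326864500 * s ^ 21 * t ^ 5 +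
      884069877848927883332888175000 * s ^ 22 * t ^ 4 +
      134853672529236410017336101250 * s ^ 23 * t ^ 3 +
      14676793342222882474203398950 * s ^ 24 * t ^ 2 +
      1014138224907230742492546510 * s ^ 25 * t ^ 1 + 33397135189129661719123427 * s ^ 26)) := by
    rw [hs, ht]
    simp only [periodDerivNum₀, periodDerivNum₁, periodDerivNum₂, energyFactor, forceFactor]
    ring
  rw [key]
  positivity

/-- The endpoint `-47/100` is admissible because `G(-47/100) < G(3/5)`: a right position beyond
`3/5` forces the left one below `-47/100`. -/
theorem opNum_lt_linear_right {x : ℝ} (h₁ : -7/10 < x) (h₂ : x < -47/100) :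
    0 < (126 - 1500 * (x ^ 2 * energyFactor x)) * forceFactor x ^ 7 -
      (periodDerivNum₂ x - 9 / 2 * (periodDerivNum₁ x * forceFactor x ^ 2) +
      5 * (periodDerivNum₀ x * forceFactor x ^ 4)) := by
  obtain ⟨s, hs⟩ : ∃ s, s = x + 7/10 := ⟨_, rfl⟩
  obtain ⟨t, ht⟩ : ∃ t, t = -47/100 - x := ⟨_, rfl⟩
  have hs0 : 0 < s := by linarith
  have ht0 : 0 < t := by linarith
  have key : (126 - 1500 * (x ^ 2 * energyFactor x)) * forceFactor x ^ 7 -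
      (periodDerivNum₂ x - 9 / 2 * (periodDerivNum₁ x * forceFactor x ^ 2) +
      5 * (periodDerivNum₀ x * forceFactor x ^ 4)) =
      (100/6859421662162037734493937506417454603 * (
    10019140556738898515737028100000000000000000000000000 * t ^ 26 +
      226960731177543667716235126760000000000000000000000000 * s ^ 1 * t ^ 25 +
      2449080305508081458774665915425000000000000000000000000 * s ^ 2 * t ^ 24 +
      16736830713992909463630028945925000000000000000000000000 * s ^ 3 * t ^ 23 +
      81224433715347535342710349976968000000000000000000000000 * s ^ 4 * t ^ 22 +
      297461010047589324750289286350773830000000000000000000000 * s ^ 5 * t ^ 21 +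
      852551759754764621089677630140465658000000000000000000000 * s ^ 6 * t ^ 20 +
      1956772176671387237056190150193907919500000000000000000000 * s ^ 7 * t ^ 19 +
      3648822217680910820477597872902111692625000000000000000000 * s ^ 8 * t ^ 18 +
      5573748230447241691953957185313770693195000000000000000000 * s ^ 9 * t ^ 17 +
      6998050841468560686049787011779280121848850000000000000000 * s ^ 10 * t ^ 16 +
      7216289046870889111409750776813669908455060000000000000000 * s ^ 11 * t ^ 15 +
      6090943594332173577585848751369423336982580000000000000000 * s ^ 12 * t ^ 14 +
      4205232507146454342415662825373772017910455000000000000000 * s ^ 13 * t ^ 13 +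
      2427754230118621799978877960856729461073338800000000000000 * s ^ 14 * t ^ 12 +
      1297313380932950038006841366776917244210966886000000000000 * s ^ 15 * t ^ 11 +
      794811853055607332110015145143258874685637918350000000000 * s ^ 16 * t ^ 10 +
      599712449064083083143936463125959665896902031200000000000 * s ^ 17 * t ^ 9 +
      452952956982650635320228579721871442585640231887500000000 * s ^ 18 * t ^ 8 +
      288448588953751156959570923846388363103523162314500000000 * s ^ 19 * t ^ 7 +
      145589666285748522340371318449741712578495784539480000000 * s ^ 20 * t ^ 6 +
      56972824082874218007370737253023270231143813060643000000 * s ^ 21 * t ^ 5 +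
      16957557985176126675265069347351135181538661953163000000 * s ^ 22 * t ^ 4 +
      3721736392500373654312201366010087752073245651881750000 * s ^ 23 * t ^ 3 +
      569460811337218565194941560974323117669175350254967500 * s ^ 24 * t ^ 2 +
      54373207324085176273709690770590058927804526173082060 * s ^ 25 * t ^ 1 +
      2443625251419752058590999461718431819558153547500751 * s ^ 26)) := by
    rw [hs, ht]
    simp only [periodDerivNum₀, periodDerivNum₁, periodDerivNum₂, energyFactor, forceFactor]
    ring
  rw [key]
  positivity

/-- The constant `8/3` is `x''(0)`, whence the factor `x`. The correction `420 u⁴` is what makes the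
jump integral positive near the saddle energy. -/
theorem num_lt_quadratic_left {x : ℝ} (h₁ : -1 < x) (h₂ : x ≤ -1/2) :
    0 < (8 / 3 - 420 * (x ^ 2 * energyFactor x) ^ 2) * forceFactor x ^ 3 - periodDerivNum₀ x := by
  obtain ⟨s, hs⟩ : ∃ s, s = x + 1 := ⟨_, rfl⟩
  obtain ⟨t, ht⟩ : ∃ t, t = -1/2 - x := ⟨_, rfl⟩
  have hs0 : 0 < s := by linarith
  have ht0 : 0 ≤ t := by linarith
  have hx : 0 < -x := by linarith
  have key : (8 / 3 - 420 * (x ^ 2 * energyFactor x) ^ 2) * forceFactor x ^ 3 - periodDerivNum₀ x =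
      -x * (4/15 * (
    2129920 * t ^ 18 + 37912576 * s ^ 1 * t ^ 17 + 317145088 * s ^ 2 * t ^ 16 +
      1624038656 * s ^ 3 * t ^ 15 + 5608628352 * s ^ 4 * t ^ 14 + 13700503488 * s ^ 5 * t ^ 13 +
      24302941216 * s ^ 6 * t ^ 12 + 31716098624 * s ^ 7 * t ^ 11 + 30508795184 * s ^ 8 * t ^ 10 +
      21449619152 * s ^ 9 * t ^ 9 + 10887547752 * s ^ 10 * t ^ 8 + 4125679680 * s ^ 11 * t ^ 7 +
      1550431596 * s ^ 12 * t ^ 6 + 883026264 * s ^ 13 * t ^ 5 + 539511516 * s ^ 14 * t ^ 4 +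
      235971216 * s ^ 15 * t ^ 3 + 65390418 * s ^ 16 * t ^ 2 + 10400616 * s ^ 17 * t ^ 1 +
      729293 * s ^ 18)) := by
    rw [hs, ht]
    simp only [periodDerivNum₀, energyFactor, forceFactor]
    ring
  rw [key]
  positivity

theorem num_lt_quadratic_right {x : ℝ} (h₁ : -1/2 < x) (h₂ : x < 0) :
    0 < (8 / 3 - 420 * (x ^ 2 * energyFactor x) ^ 2) * forceFactor x ^ 3 - periodDerivNum₀ x := by
  obtain ⟨s, hs⟩ : ∃ s, s = x + 1/2 := ⟨_, rfl⟩
  obtain ⟨t, ht⟩ : ∃ t, t = -x := ⟨_, rfl⟩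
  have hs0 : 0 < s := by linarith
  have ht0 : 0 < t := by linarith
  have hx : 0 < -x := by linarith
  have key : (8 / 3 - 420 * (x ^ 2 * energyFactor x) ^ 2) * forceFactor x ^ 3 - periodDerivNum₀ x =
      -x * (4/15 * (
    729293 * t ^ 18 + 15853932 * s ^ 1 * t ^ 17 + 158096790 * s ^ 2 * t ^ 16 +
      959411760 * s ^ 3 * t ^ 15 + 3974609916 * s ^ 4 * t ^ 14 + 11963638392 * s ^ 5 * t ^ 13 +
      27189404748 * s ^ 6 * t ^ 12 + 47838831648 * s ^ 7 * t ^ 11 + 66236977800 * s ^ 8 * t ^ 10 +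
      72887640912 * s ^ 9 * t ^ 9 + 64031321840 * s ^ 10 * t ^ 8 + 44880192960 * s ^ 11 * t ^ 7 +
      24946840736 * s ^ 12 * t ^ 6 + 10859204288 * s ^ 13 * t ^ 5 + 3622756992 * s ^ 14 * t ^ 4 +
      894064896 * s ^ 15 * t ^ 3 + 153698304 * s ^ 16 * t ^ 2 + 16416768 * s ^ 17 * t ^ 1 +
      819200 * s ^ 18)) := by
    rw [hs, ht]
    simp only [periodDerivNum₀, energyFactor, forceFactor]
    ring
  rw [key]
  positivity

theorem neg_six_lt_num_left {x : ℝ} (h₁ : 0 < x) (h₂ : x ≤ 1/2) :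
    0 < periodDerivNum₀ x + 6 * forceFactor x ^ 3 := by
  obtain ⟨s, hs⟩ : ∃ s, s = x := ⟨_, rfl⟩
  obtain ⟨t, ht⟩ : ∃ t, t = 1/2 - x := ⟨_, rfl⟩
  have hs0 : 0 < s := by linarith
  have ht0 : 0 ≤ t := by linarith
  have key : periodDerivNum₀ x + 6 * forceFactor x ^ 3 =
      (2/15 * (
    4160 * t ^ 9 + 32800 * s ^ 1 * t ^ 8 + 112496 * s ^ 2 * t ^ 7 + 221016 * s ^ 3 * t ^ 6 +
      274160 * s ^ 4 * t ^ 5 + 221476 * s ^ 5 * t ^ 4 + 115164 * s ^ 6 * t ^ 3 +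
      36502 * s ^ 7 * t ^ 2 + 6200 * s ^ 8 * t ^ 1 + 431 * s ^ 9)) := by
    rw [hs, ht]
    simp only [periodDerivNum₀, forceFactor]
    ring
  rw [key]
  positivity

theorem neg_six_lt_num_mid {x : ℝ} (h₁ : 1/2 < x) (h₂ : x ≤ 3/4) :
    0 < periodDerivNum₀ x + 6 * forceFactor x ^ 3 := by
  obtain ⟨s, hs⟩ : ∃ s, s = x - 1/2 := ⟨_, rfl⟩
  obtain ⟨t, ht⟩ : ∃ t, t = 3/4 - x := ⟨_, rfl⟩
  have hs0 : 0 < s := by linarith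
  have ht0 : 0 ≤ t := by linarith
  have key : periodDerivNum₀ x + 6 * forceFactor x ^ 3 =
      (2/15 * (
    220672 * t ^ 9 + 1391872 * s ^ 1 * t ^ 8 + 3500288 * s ^ 2 * t ^ 7 + 4255104 * s ^ 3 * t ^ 6 +
      2297216 * s ^ 4 * t ^ 5 + 601408 * s ^ 5 * t ^ 4 + 1453296 * s ^ 6 * t ^ 3 +
      2380264 * s ^ 7 * t ^ 2 + 1498538 * s ^ 8 * t ^ 1 + 341407 * s ^ 9)) := by
    rw [hs, ht]
    simp only [periodDerivNum₀, forceFactor]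
    ring
  rw [key]
  positivity

theorem neg_six_lt_num_right {x : ℝ} (h₁ : 3/4 < x) (h₂ : x < 1) :
    0 < periodDerivNum₀ x + 6 * forceFactor x ^ 3 := by
  obtain ⟨s, hs⟩ : ∃ s, s = x - 3/4 := ⟨_, rfl⟩
  obtain ⟨t, ht⟩ : ∃ t, t = 1 - x := ⟨_, rfl⟩
  have hs0 : 0 < s := by linarith
  have ht0 : 0 < t := by linarith
  have key : periodDerivNum₀ x + 6 * forceFactor x ^ 3 =
      (2/15 * (
    341407 * t ^ 9 + 4646788 * s ^ 1 * t ^ 8 + 27566264 * s ^ 2 * t ^ 7 + 93459648 * s ^ 3 * t ^ 6 +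
      200035520 * s ^ 4 * t ^ 5 + 281183488 * s ^ 5 * t ^ 4 + 260378112 * s ^ 6 * t ^ 3 +
      153579520 * s ^ 7 * t ^ 2 + 52477952 * s ^ 8 * t ^ 1 + 7929856 * s ^ 9)) := by
    rw [hs, ht]
    simp only [periodDerivNum₀, forceFactor]
    ring
  rw [key]
  positivity

/-- Together with `affine_lt_num`, this bounds the jump of `x''` by `3 - 64 u²` for `r = 3/10`. The
points `337/500` and `-541/1000` lie just outside the turning positions of energy `9/100`. -/
theorem num_lt_affine_left {x : ℝ} (h₁ : 0 < x) (h₂ : x ≤ 337/1000) :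
    0 < (9 / 2 - 108 * (x ^ 2 * energyFactor x)) * forceFactor x ^ 3 - periodDerivNum₀ x := by
  obtain ⟨s, hs⟩ : ∃ s, s = x := ⟨_, rfl⟩
  obtain ⟨t, ht⟩ : ∃ t, t = 337/1000 - x := ⟨_, rfl⟩
  have hs0 : 0 < s := by linarith
  have ht0 : 0 ≤ t := by linarith
  have key : (9 / 2 - 108 * (x ^ 2 * energyFactor x)) * forceFactor x ^ 3 - periodDerivNum₀ x =
      (4/3655189279250904993123795919595356335 * (
    859375000000000000000000000000000000000000 * t ^ 14 +
      10109296875000000000000000000000000000000000 * s ^ 1 * t ^ 13 +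
      53521176546875000000000000000000000000000000 * s ^ 2 * t ^ 12 +
      168510715056703125000000000000000000000000000 * s ^ 3 * t ^ 11 +
      351102069878345781250000000000000000000000000 * s ^ 4 * t ^ 10 +
      509777222467829611562500000000000000000000000 * s ^ 5 * t ^ 9 +
      530015239167441175310250000000000000000000000 * s ^ 6 * t ^ 8 +
      402332752671759782979565125000000000000000000 * s ^ 7 * t ^ 7 +
      230962858882967385183388123125000000000000000 * s ^ 8 * t ^ 6 +
      110081408066635704835881259445500000000000000 * s ^ 9 * t ^ 5 +
      50502523354702991058270478138962000000000000 * s ^ 10 * t ^ 4 +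
      22564969857355464320904463335774829250000000 * s ^ 11 * t ^ 3 +
      8013053403309139891659293244862501059000000 * s ^ 12 * t ^ 2 +
      1776388391957493037153675560748514368000000 * s ^ 13 * t ^ 1 +
      176437415577601087549665964700876744075791 * s ^ 14)) := by
    rw [hs, ht]
    simp only [periodDerivNum₀, energyFactor, forceFactor]
    ring
  rw [key]
  positivity

theorem num_lt_affine_right {x : ℝ} (h₁ : 337/1000 < x) (h₂ : x < 337/500) :
    0 < (9 / 2 - 108 * (x ^ 2 * energyFactor x)) * forceFactor x ^ 3 - periodDerivNum₀ x := by
  obtain ⟨s, hs⟩ : ∃ s, s = x - 337/1000 := ⟨_, rfl⟩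
  obtain ⟨t, ht⟩ : ∃ t, t = 337/500 - x := ⟨_, rfl⟩
  have hs0 : 0 < s := by linarith
  have ht0 : 0 < t := by linarith
  have key : (9 / 2 - 108 * (x ^ 2 * energyFactor x)) * forceFactor x ^ 3 - periodDerivNum₀ x =
      (4/3655189279250904993123795919595356335 * (
    176437415577601087549665964700876744075791 * t ^ 14 +
      3163859244215337414236971450876034466122148 * s ^ 1 * t ^ 13 +
      26050174482661116793742139816520262334587924 * s ^ 2 * t ^ 12 +
      129300887693300432431599088796341792098703392 * s ^ 3 * t ^ 11 +
      430964292058610656584266109052257095209868656 * s ^ 4 * t ^ 10 +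
      1020053067803023902794654428055242791391474624 * s ^ 5 * t ^ 9 +
      1768654700342153103182349208131481242982423872 * s ^ 6 * t ^ 8 +
      2281729410243170143217758928747156613582683136 * s ^ 7 * t ^ 7 +
      2197662416705922021775862395504035880217695488 * s ^ 8 * t ^ 6 +
      1566667134247198072553776860069281959031593984 * s ^ 9 * t ^ 5 +
      807275388465610559590816211975970558583593984 * s ^ 10 * t ^ 4 +
      286817413416837535900746488070728055476068352 * s ^ 11 * t ^ 3 +
      63999438012563746426348643881634769498034176 * s ^ 12 * t ^ 2 +
      7216066507130317274778061503848311284318208 * s ^ 13 * t ^ 1 +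
      164971933754828191729489498376905945759744 * s ^ 14)) := by
    rw [hs, ht]
    simp only [periodDerivNum₀, energyFactor, forceFactor]
    ring
  rw [key]
  positivity

theorem affine_lt_num {x : ℝ} (h₁ : -541/1000 < x) (h₂ : x < 0) :
    0 < periodDerivNum₀ x - (3 / 2 - 44 * (x ^ 2 * energyFactor x)) * forceFactor x ^ 3 := by
  obtain ⟨s, hs⟩ : ∃ s, s = x + 541/1000 := ⟨_, rfl⟩
  obtain ⟨t, ht⟩ : ∃ t, t = -x := ⟨_, rfl⟩
  have hs0 : 0 < s := by linarith
  have ht0 : 0 < t := by linarith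
  have key : periodDerivNum₀ x - (3 / 2 - 44 * (x ^ 2 * energyFactor x)) * forceFactor x ^ 3 =
      (4/2759643426774268182076988398084601987415 * (
    418925992627028310243350129987570137372313 * t ^ 14 +
      7715451942892236142845119751947922276000000 * s ^ 1 * t ^ 13 +
      50238281379776565211664547535576492513000000 * s ^ 2 * t ^ 12 +
      169038520352955027098127192790606354250000000 * s ^ 3 * t ^ 11 +
      337701547596974123568361680079716000000000000 * s ^ 4 * t ^ 10 +
      431068864646748061785548057703250000000000000 * s ^ 5 * t ^ 9 +
      386920514713306672045693361875000000000000000 * s ^ 6 * t ^ 8 +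
      315412969865869631774567000000000000000000000 * s ^ 7 * t ^ 7 +
      313243089419510941430125000000000000000000000 * s ^ 8 * t ^ 6 +
      313521052200481939125000000000000000000000000 * s ^ 9 * t ^ 5 +
      235159111824524843750000000000000000000000000 * s ^ 10 * t ^ 4 +
      118195861624109375000000000000000000000000000 * s ^ 11 * t ^ 3 +
      37583649046875000000000000000000000000000000 * s ^ 12 * t ^ 2 +
      6853203125000000000000000000000000000000000 * s ^ 13 * t ^ 1 +
      546875000000000000000000000000000000000000 * s ^ 14)) := by
    rw [hs, ht]
    simp only [periodDerivNum₀, energyFactor, forceFactor]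
    ring
  rw [key]
  positivity

theorem lt_num_of_pos {x : ℝ} (h₁ : 0 < x) (h₂ : x < 1/5) :
    0 < periodDerivNum₀ x - 8 / 3 * forceFactor x ^ 3 := by
  obtain ⟨s, hs⟩ : ∃ s, s = x := ⟨_, rfl⟩
  obtain ⟨t, ht⟩ : ∃ t, t = 1/5 - x := ⟨_, rfl⟩
  have hs0 : 0 < s := by linarith
  have ht0 : 0 < t := by linarith
  have hx : 0 < x := by linarith
  have key : periodDerivNum₀ x - 8 / 3 * forceFactor x ^ 3 =
      x * (1/6 * (
    1953125 * t ^ 8 + 14031250 * s ^ 1 * t ^ 7 + 43512500 * s ^ 2 * t ^ 6 +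
      75868750 * s ^ 3 * t ^ 5 + 81019250 * s ^ 4 * t ^ 4 + 53917750 * s ^ 5 * t ^ 3 +
      21607100 * s ^ 6 * t ^ 2 + 4675450 * s ^ 7 * t ^ 1 + 401209 * s ^ 8)) := by
    rw [hs, ht]
    simp only [periodDerivNum₀, forceFactor]
    ring
  rw [key]
  positivity

/-! ### Integrals depending on a parameter, and sign changes from an Euler inequality -/

/-- Differentiation of `∫ f (r sin θ) w θ` under the integral sign. -/
theorem hasDerivAt_integral_comp_mul_sin {f f' w : ℝ → ℝ} {ρ r : ℝ} (hr : r ∈ Ioo (-ρ) ρ)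
    (hf : ∀ u ∈ Ioo (-ρ) ρ, HasDerivAt f (f' u) u) (hf' : ContinuousOn f' (Ioo (-ρ) ρ))
    (hw : Continuous w) :
    HasDerivAt (fun r => ∫ θ in (0 : ℝ)..Real.pi, f (r * Real.sin θ) * w θ)
      (∫ θ in (0 : ℝ)..Real.pi, f' (r * Real.sin θ) * Real.sin θ * w θ) r := by
  have hr' : |r| < ρ := abs_lt.mpr hr
  -- On the compact interval `[-R, R]` the derivative `f'` is bounded, which gives the dominating
  -- function; `f'` may be unbounded near `±ρ`.
  obtain ⟨R, hrR, hRρ⟩ := exists_between hr'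
  have hmem : ∀ x ∈ Icc (-R) R, ∀ θ, x * Real.sin θ ∈ Icc (-R) R := by
    intro x hx θ
    have h1 : |x| ≤ R := abs_le.mpr hx
    apply abs_le.mp
    rw [abs_mul]
    calc |x| * |Real.sin θ| ≤ |x| * 1 :=
          mul_le_mul_of_nonneg_left (Real.abs_sin_le_one θ) (abs_nonneg x)
      _ ≤ R := by linarith
  have hsub : Icc (-R) R ⊆ Ioo (-ρ) ρ := fun x hx => ⟨by linarith [hx.1], by linarith [hx.2]⟩
  have hfc : ContinuousOn f (Ioo (-ρ) ρ) := fun u hu => (hf u hu).continuousAt.continuousWithinAt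
  have hcomp : ∀ g : ℝ → ℝ, ContinuousOn g (Ioo (-ρ) ρ) → ∀ x ∈ Icc (-R) R,
      Continuous fun θ => g (x * Real.sin θ) := fun g hg x hx =>
    hg.comp_continuous (by fun_prop) fun θ => hsub (hmem x hx θ)
  obtain ⟨C, hC⟩ := (isCompact_Icc (a := -R) (b := R)).exists_bound_of_continuousOn
    (hf'.mono hsub)
  have hrmem : r ∈ Ioo (-R) R := abs_lt.mp hrR
  refine (intervalIntegral.hasDerivAt_integral_of_dominated_loc_of_deriv_le (μ := volume)
    (F := fun r θ => f (r * Real.sin θ) * w θ)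
    (F' := fun r θ => f' (r * Real.sin θ) * Real.sin θ * w θ)
    (s := Ioo (-R) R) (bound := fun θ => C * |w θ|)
    (Ioo_mem_nhds hrmem.1 hrmem.2) ?_ ?_ ?_ ?_ ?_ ?_).2
  · filter_upwards [Ioo_mem_nhds hrmem.1 hrmem.2] with x hx
    exact ((hcomp f hfc x (Ioo_subset_Icc_self hx)).mul hw).aestronglyMeasurable
  · exact ((hcomp f hfc r (Ioo_subset_Icc_self hrmem)).mul hw).intervalIntegrable _ _
  · exact (((hcomp f' hf' r (Ioo_subset_Icc_self hrmem)).mul Real.continuous_sin).mul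
      hw).aestronglyMeasurable
  · refine Eventually.of_forall fun θ _ x hx => ?_
    have h1 := hC _ (hmem x (Ioo_subset_Icc_self hx) θ)
    rw [norm_mul, norm_mul, Real.norm_eq_abs (w θ)]
    refine mul_le_mul_of_nonneg_right ?_ (abs_nonneg _)
    calc ‖f' (x * Real.sin θ)‖ * ‖Real.sin θ‖ ≤ ‖f' (x * Real.sin θ)‖ * 1 :=
          mul_le_mul_of_nonneg_left (Real.abs_sin_le_one θ) (norm_nonneg _)
      _ ≤ C := by linarith
  · exact (continuous_const.mul hw.abs).intervalIntegrable _ _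
  · refine Eventually.of_forall fun θ _ x hx => ?_
    have h1 := hf _ (hsub (hmem x (Ioo_subset_Icc_self hx) θ))
    have h2 : HasDerivAt (fun x => x * Real.sin θ) (Real.sin θ) x := by
      simpa using (hasDerivAt_id x).mul_const (Real.sin θ)
    exact (h1.comp x h2).mul_const (w θ)

/-- If `(D - 2)(D - 5/2) F₀ > 0` for the Euler operator `D = r d/dr`, then `F₀ / r²` is strictly
quasiconvex. -/
theorem div_sq_lt_max_of_euler_pos {F₀ F₁ F₂ : ℝ → ℝ} {ρ : ℝ}
    (h₀ : ∀ r ∈ Ioo 0 ρ, HasDerivAt F₀ (F₁ r / r) r)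
    (h₁ : ∀ r ∈ Ioo 0 ρ, HasDerivAt F₁ (F₂ r / r) r)
    (hpos : ∀ r ∈ Ioo 0 ρ, 0 < F₂ r - 9 / 2 * F₁ r + 5 * F₀ r)
    {a b c : ℝ} (ha : 0 < a) (hab : a < b) (hbc : b < c) (hc : c < ρ) :
    F₀ b / b ^ 2 < max (F₀ a / a ^ 2) (F₀ c / c ^ 2) := by
  have hE : ∀ r ∈ Ioo 0 ρ,
      HasDerivAt (fun r => F₀ r / r ^ 2) ((F₁ r - 2 * F₀ r) / r ^ 3) r := by
    intro r hr
    have hr0 : r ≠ 0 := hr.1.ne'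
    have h := (h₀ r hr).div (hasDerivAt_pow 2 r) (pow_ne_zero 2 hr0)
    refine h.congr_deriv ?_
    field_simp
    norm_num
    ring
  -- The factor `r^(-5/2)`, written with `r² √r`, is the integrating factor of `D - 5/2`.
  have hS : ∀ r ∈ Ioo 0 ρ, HasDerivAt (fun r => (F₁ r - 2 * F₀ r) / (r ^ 2 * √r))
      ((F₂ r - 9 / 2 * F₁ r + 5 * F₀ r) / (r ^ 3 * √r)) r := by
    intro r hr
    have hr0 : r ≠ 0 := hr.1.ne'
    have hs0 : √r ≠ 0 := (Real.sqrt_pos.mpr hr.1).ne'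
    have h := ((h₁ r hr).sub ((h₀ r hr).const_mul 2)).div
      ((hasDerivAt_pow 2 r).mul (Real.hasDerivAt_sqrt hr0))
      (mul_ne_zero (pow_ne_zero 2 hr0) hs0)
    refine h.congr_deriv ?_
    have hsq : √r ^ 2 = r := Real.sq_sqrt hr.1.le
    obtain ⟨z, hz⟩ : ∃ z, z = √r := ⟨_, rfl⟩
    rw [← hz] at hs0 hsq ⊢
    simp only [Pi.mul_apply, Pi.sub_apply, ← hz]
    clear h hz
    generalize F₀ r = A, F₁ r = B, F₂ r = C at *
    clear hr h₀ h₁ hpos hE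
    subst hsq
    field_simp
    norm_num
    ring
  have hSm : StrictMonoOn (fun r => (F₁ r - 2 * F₀ r) / (r ^ 2 * √r)) (Ioo 0 ρ) := by
    refine strictMonoOn_of_deriv_pos (convex_Ioo 0 ρ)
      (fun r hr => (hS r hr).continuousAt.continuousWithinAt) fun r hr => ?_
    rw [interior_Ioo] at hr
    rw [(hS r hr).deriv]
    have := Real.sqrt_pos.mpr hr.1
    have := hr.1
    exact div_pos (hpos r hr) (by positivity)
  -- Otherwise the mean value theorem gives a nonnegative slope of `F₀ / r²` at some `p < b` and a
  -- nonpositive one at some `q > b`, against the strict growth of `(D - 2)F₀ / r^(5/2)`.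
  by_contra hcon
  rw [not_lt, max_le_iff] at hcon
  have sub1 : Icc a b ⊆ Ioo 0 ρ := fun x hx => ⟨by linarith [hx.1], by linarith [hx.2]⟩
  have sub2 : Icc b c ⊆ Ioo 0 ρ := fun x hx => ⟨by linarith [hx.1], by linarith [hx.2]⟩
  obtain ⟨p, hp, hp'⟩ := exists_hasDerivAt_eq_slope (fun r => F₀ r / r ^ 2) _ hab
    (fun x hx => (hE x (sub1 hx)).continuousAt.continuousWithinAt)
    fun x hx => hE x (sub1 (Ioo_subset_Icc_self hx))
  obtain ⟨q, hq, hq'⟩ := exists_hasDerivAt_eq_slope (fun r => F₀ r / r ^ 2) _ hbc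
    (fun x hx => (hE x (sub2 hx)).continuousAt.continuousWithinAt)
    fun x hx => hE x (sub2 (Ioo_subset_Icc_self hx))
  have hp0 := sub1 (Ioo_subset_Icc_self hp)
  have hq0 := sub2 (Ioo_subset_Icc_self hq)
  have hpq := hSm hp0 hq0 (hp.2.trans hq.1)
  have e1 : 0 ≤ (F₁ p - 2 * F₀ p) / p ^ 3 := by
    rw [hp']; exact div_nonneg (by linarith [hcon.1]) (by linarith)
  have e2 : (F₁ q - 2 * F₀ q) / q ^ 3 ≤ 0 := by
    rw [hq']; exact div_nonpos_of_nonpos_of_nonneg (by linarith [hcon.2]) (by linarith)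
  have e3 : 0 ≤ F₁ p - 2 * F₀ p := by
    by_contra h
    exact absurd (div_neg_of_neg_of_pos (not_le.mp h) (pow_pos hp0.1 3)) (not_lt.mpr e1)
  have e4 : F₁ q - 2 * F₀ q ≤ 0 := by
    by_contra h
    exact absurd (div_pos (not_le.mp h) (pow_pos hq0.1 3)) (not_lt.mpr e2)
  have hpp : 0 < p := hp0.1
  have hqq : 0 < q := hq0.1
  have e5 : 0 ≤ (F₁ p - 2 * F₀ p) / (p ^ 2 * √p) := div_nonneg e3 (by positivity)
  have e6 : (F₁ q - 2 * F₀ q) / (q ^ 2 * √q) ≤ 0 :=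
    div_nonpos_of_nonpos_of_nonneg e4 (by positivity)
  exact absurd hpq (not_lt.mpr (e6.trans e5))

/-- Sign pattern `+, -, +` of a function with `(D - 2)(D - 5/2) F₀ > 0` that takes these signs. -/
theorem exists_two_sign_changes {F₀ F₁ F₂ : ℝ → ℝ} {ρ : ℝ}
    (h₀ : ∀ r ∈ Ioo 0 ρ, HasDerivAt F₀ (F₁ r / r) r)
    (h₁ : ∀ r ∈ Ioo 0 ρ, HasDerivAt F₁ (F₂ r / r) r)
    (hpos : ∀ r ∈ Ioo 0 ρ, 0 < F₂ r - 9 / 2 * F₁ r + 5 * F₀ r)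
    {a b c : ℝ} (ha : 0 < a) (hab : a < b) (hbc : b < c) (hc : c < ρ)
    (hFa : 0 < F₀ a) (hFb : F₀ b < 0) (hFc : 0 < F₀ c) :
    ∃ r₁ r₂, 0 < r₁ ∧ r₁ < r₂ ∧ r₂ < ρ ∧ F₀ r₁ = 0 ∧ F₀ r₂ = 0 ∧
      (∀ r ∈ Ioo 0 r₁, 0 < F₀ r) ∧ (∀ r ∈ Ioo r₁ r₂, F₀ r < 0) ∧ ∀ r ∈ Ioo r₂ ρ, 0 < F₀ r := by
  have hcont : ContinuousOn F₀ (Ioo 0 ρ) :=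
    fun r hr => (h₀ r hr).continuousAt.continuousWithinAt
  have hq := fun x y z => @div_sq_lt_max_of_euler_pos F₀ F₁ F₂ ρ h₀ h₁ hpos x y z
  obtain ⟨r₁, hr₁, hF₁⟩ := intermediate_value_Ioo' hab.le
    (hcont.mono fun x hx => ⟨by linarith [hx.1], by linarith [hx.2]⟩) ⟨hFb, hFa⟩
  obtain ⟨r₂, hr₂, hF₂⟩ := intermediate_value_Ioo hbc.le
    (hcont.mono fun x hx => ⟨by linarith [hx.1], by linarith [hx.2]⟩) ⟨hFb, hFc⟩
  have hb0 : 0 < b := ha.trans hab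
  have hFb' : F₀ b / b ^ 2 < 0 := div_neg_of_neg_of_pos hFb (by positivity)
  have hr₁0 : 0 < r₁ := ha.trans hr₁.1
  have hr₂ρ : r₂ < ρ := hr₂.2.trans hc
  refine ⟨r₁, r₂, hr₁0, hr₁.2.trans hr₂.1, hr₂ρ, hF₁, hF₂, fun r hr => ?_, fun r hr => ?_,
    fun r hr => ?_⟩
  -- Quasiconvexity is applied with a zero as the middle point for the outer intervals, and between
  -- the two zeros for the inner one.
  · have h := hq r r₁ b hr.1 hr.2 hr₁.2 (by linarith)
    rw [hF₁, zero_div, lt_max_iff] at h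
    exact (div_pos_iff_of_pos_right (pow_pos hr.1 2)).mp
      (h.resolve_right (not_lt.mpr hFb'.le))
  · have h := hq r₁ r r₂ hr₁0 hr.1 hr.2 hr₂ρ
    rw [hF₁, hF₂, zero_div, zero_div, max_self] at h
    by_contra hn
    exact absurd (div_nonneg (not_lt.mp hn) (sq_nonneg r)) (not_le.mpr h)
  · have h := hq b r₂ r hb0 hr₂.1 hr.1 hr.2
    rw [hF₂, zero_div, lt_max_iff] at h
    have hr0 : 0 < r := by linarith [hr.1, hr₂.1]
    exact (div_pos_iff_of_pos_right (pow_pos hr0 2)).mp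
      (h.resolve_left (not_lt.mpr hFb'.le))

/-! ### The coordinate `u = x √P(x)`, its inverse and the derivatives of the inverse -/

/-- The derivative of `periodDerivNum₀`. -/
def periodDerivNum₀Deriv (x : ℝ) : ℝ :=
  - 1/6 - 24/5 * x + 22/5 * x ^ 2 - 6 * x ^ 4

theorem hasDerivAt_periodDerivNum₀ (x : ℝ) :
    HasDerivAt periodDerivNum₀ (periodDerivNum₀Deriv x) x := by
  refine HasDerivAt.congr_deriv (f := periodDerivNum₀)
    (((((hasDerivAt_const x (1/3 : ℝ)).sub
    ((hasDerivAt_id' x).const_mul (1/6 : ℝ))).sub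
    ((hasDerivAt_pow 2 x).const_mul (12/5 : ℝ))).add
    ((hasDerivAt_pow 3 x).const_mul (22/15 : ℝ))).sub
    ((hasDerivAt_pow 5 x).const_mul (6/5 : ℝ))) ?_
  simp only [periodDerivNum₀Deriv]
  norm_num
  ring

/-- The derivative of `periodDerivNum₁`. -/
def periodDerivNum₁Deriv (x : ℝ) : ℝ :=
  5/24 - 128/45 * x - 13/30 * x ^ 2 + 6 * x ^ 3 + 2443/90 * x ^ 4 - 276/5 * x ^ 5 + 322/15 * x ^ 6
    + 1584/25 * x ^ 7 - 1044/25 * x ^ 8 + 528/25 * x ^ 10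

theorem hasDerivAt_periodDerivNum₁ (x : ℝ) :
    HasDerivAt periodDerivNum₁ (periodDerivNum₁Deriv x) x := by
  refine HasDerivAt.congr_deriv (f := periodDerivNum₁)
    (((((((((((hasDerivAt_id' x).const_mul (5/24 : ℝ)).sub
    ((hasDerivAt_pow 2 x).const_mul (64/45 : ℝ))).sub
    ((hasDerivAt_pow 3 x).const_mul (13/90 : ℝ))).add
    ((hasDerivAt_pow 4 x).const_mul (3/2 : ℝ))).add
    ((hasDerivAt_pow 5 x).const_mul (2443/450 : ℝ))).sub
    ((hasDerivAt_pow 6 x).const_mul (46/5 : ℝ))).add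
    ((hasDerivAt_pow 7 x).const_mul (46/15 : ℝ))).add
    ((hasDerivAt_pow 8 x).const_mul (198/25 : ℝ))).sub
    ((hasDerivAt_pow 9 x).const_mul (116/25 : ℝ))).add
    ((hasDerivAt_pow 11 x).const_mul (48/25 : ℝ))) ?_
  simp only [periodDerivNum₁Deriv]
  norm_num
  ring

/-- The derivative of `forceFactor`. -/
def forceFactorDeriv (x : ℝ) : ℝ := 3 * x ^ 2 - 1 / 2

theorem hasDerivAt_forceFactor (x : ℝ) : HasDerivAt forceFactor (forceFactorDeriv x) x := by
  refine HasDerivAt.congr_deriv (f := forceFactor)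
    (((hasDerivAt_pow 3 x).sub ((hasDerivAt_id' x).div_const 2)).add
      (hasDerivAt_const x (1 / 2 : ℝ))) ?_
  simp only [forceFactorDeriv]
  norm_num

theorem hasDerivAt_energyFactor (x : ℝ) :
    HasDerivAt energyFactor (3 * x ^ 2 / 5 - 1 / 6) x := by
  refine HasDerivAt.congr_deriv (f := energyFactor)
    ((((hasDerivAt_pow 3 x).div_const 5).sub ((hasDerivAt_id' x).div_const 6)).add
      (hasDerivAt_const x (1 / 4 : ℝ))) ?_
  norm_num

theorem forceFactor_pos {x : ℝ} (hx : -1 < x) : 0 < forceFactor x := by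
  have h : forceFactor x = (x + 1) * ((x - 1 / 2) ^ 2 + 1 / 4) := by
    unfold forceFactor; ring
  rw [h]
  have : 0 < x + 1 := by linarith
  positivity

theorem energyFactor_pos {x : ℝ} (hx : -1 ≤ x) : 0 < energyFactor x := by
  -- The product is `x³ - 3a²x + 2a³` with `a = 5/9`, a rational point close to the minimiser
  -- `√(5/18)` of `P`.
  have h := mul_nonneg (sq_nonneg (x - 5 / 9)) (show 0 ≤ x + 10 / 9 by linarith)
  unfold energyFactor
  nlinarith

theorem continuous_energyFactor : Continuous energyFactor := by unfold energyFactor; fun_prop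

/-- The signed square root `u = x √P(x)` of the potential energy. -/
def signedRoot (x : ℝ) : ℝ := x * √(energyFactor x)

/-- The signed square root of the energy of the saddle. -/
def rootMax : ℝ := √(13 / 60)

theorem rootMax_sq : rootMax ^ 2 = 13 / 60 := Real.sq_sqrt (by norm_num)

theorem rootMax_pos : 0 < rootMax := Real.sqrt_pos.mpr (by norm_num)

theorem signedRoot_sq {x : ℝ} (hx : -1 ≤ x) : signedRoot x ^ 2 = x ^ 2 * energyFactor x := by
  rw [signedRoot, mul_pow, Real.sq_sqrt (energyFactor_pos hx).le]

theorem hasDerivAt_signedRoot {x : ℝ} (hx : -1 ≤ x) :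
    HasDerivAt signedRoot (forceFactor x / (2 * √(energyFactor x))) x := by
  have hP := energyFactor_pos hx
  have h := (hasDerivAt_id' x).mul ((hasDerivAt_energyFactor x).sqrt hP.ne')
  refine HasDerivAt.congr_deriv (f := signedRoot) h ?_
  have hs := Real.sqrt_pos.mpr hP
  have hsq := Real.sq_sqrt hP.le
  field_simp
  rw [hsq]
  unfold energyFactor forceFactor
  ring

theorem continuous_signedRoot : Continuous signedRoot := by
  unfold signedRoot
  exact continuous_id.mul continuous_energyFactor.sqrt

theorem strictMonoOn_signedRoot : StrictMonoOn signedRoot (Ici (-1)) := by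
  refine strictMonoOn_of_deriv_pos (convex_Ici _) continuous_signedRoot.continuousOn
    fun x hx => ?_
  rw [interior_Ici] at hx
  have hx : -1 < x := hx
  rw [(hasDerivAt_signedRoot hx.le).deriv]
  have := Real.sqrt_pos.mpr (energyFactor_pos hx.le)
  have := forceFactor_pos hx
  positivity

theorem signedRoot_neg_one : signedRoot (-1) = -rootMax := by
  rw [signedRoot, rootMax, energyFactor]
  norm_num

/-- The right end of the homoclinic loop lies before `x = 1`, so every position inside the loop lies
in `(-1, 1)`. -/
theorem rootMax_lt_signedRoot_one : rootMax < signedRoot 1 := by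
  rw [signedRoot, rootMax, energyFactor, one_mul]
  exact Real.sqrt_lt_sqrt (by norm_num) (by norm_num)

theorem signedRoot_zero : signedRoot 0 = 0 := by simp [signedRoot]

/-- The inverse of `signedRoot`: the position as a function of the signed root of the potential
energy. -/
def position (u : ℝ) : ℝ := Function.invFunOn signedRoot (Ioo (-1) 1) u

theorem exists_signedRoot_eq {u : ℝ} (hu : u ∈ Ioo (-rootMax) rootMax) :
    ∃ x ∈ Ioo (-1 : ℝ) 1, signedRoot x = u :=
  intermediate_value_Ioo (by norm_num) continuous_signedRoot.continuousOn
    ⟨by rw [signedRoot_neg_one]; exact hu.1, hu.2.trans rootMax_lt_signedRoot_one⟩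

theorem position_mem {u : ℝ} (hu : u ∈ Ioo (-rootMax) rootMax) :
    position u ∈ Ioo (-1 : ℝ) 1 :=
  Function.invFunOn_mem (exists_signedRoot_eq hu)

theorem neg_one_lt_position {u : ℝ} (hu : u ∈ Ioo (-rootMax) rootMax) : -1 < position u :=
  (position_mem hu).1

theorem signedRoot_position {u : ℝ} (hu : u ∈ Ioo (-rootMax) rootMax) :
    signedRoot (position u) = u :=
  Function.invFunOn_eq (exists_signedRoot_eq hu)

theorem position_signedRoot {x : ℝ} (hx : -1 < x)
    (hu : signedRoot x ∈ Ioo (-rootMax) rootMax) : position (signedRoot x) = x :=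
  strictMonoOn_signedRoot.injOn (neg_one_lt_position hu).le hx.le (signedRoot_position hu)

theorem strictMonoOn_position : StrictMonoOn position (Ioo (-rootMax) rootMax) := by
  intro u hu v hv huv
  rw [← strictMonoOn_signedRoot.lt_iff_lt (neg_one_lt_position hu).le
    (neg_one_lt_position hv).le, signedRoot_position hu, signedRoot_position hv]
  exact huv

theorem zero_mem_Ioo_rootMax : (0 : ℝ) ∈ Ioo (-rootMax) rootMax :=
  ⟨neg_lt_zero.mpr rootMax_pos, rootMax_pos⟩

theorem position_zero : position 0 = 0 := by
  have h := position_signedRoot (x := 0) (by norm_num)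
    (by rw [signedRoot_zero]; exact zero_mem_Ioo_rootMax)
  rwa [signedRoot_zero] at h

theorem position_sq_mul {u : ℝ} (hu : u ∈ Ioo (-rootMax) rootMax) :
    position u ^ 2 * energyFactor (position u) = u ^ 2 := by
  rw [← signedRoot_sq (neg_one_lt_position hu).le, signedRoot_position hu]

/-- A strictly monotone function is continuous where its image is a neighbourhood of the value; here
the image contains an open set cut out by the continuous `signedRoot`. -/
theorem continuousAt_position {u : ℝ} (hu : u ∈ Ioo (-rootMax) rootMax) :
    ContinuousAt position u := by
  refine strictMonoOn_position.continuousAt_of_image_mem_nhds (Ioo_mem_nhds hu.1 hu.2) ?_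
  have hopen : IsOpen (signedRoot ⁻¹' Ioo (-rootMax) rootMax ∩ Ioi (-1)) :=
    (isOpen_Ioo.preimage continuous_signedRoot).inter isOpen_Ioi
  refine mem_of_superset (hopen.mem_nhds ⟨?_, neg_one_lt_position hu⟩) ?_
  · rw [mem_preimage, signedRoot_position hu]; exact hu
  · rintro x ⟨hx, hx1⟩
    exact ⟨signedRoot x, hx, position_signedRoot hx1 hx⟩

/-- The derivative of `position`. -/
def stretch (u : ℝ) : ℝ := 2 * √(energyFactor (position u)) / forceFactor (position u)

theorem stretch_pos {u : ℝ} (hu : u ∈ Ioo (-rootMax) rootMax) : 0 < stretch u := by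
  have := Real.sqrt_pos.mpr (energyFactor_pos (neg_one_lt_position hu).le)
  have := forceFactor_pos (neg_one_lt_position hu)
  unfold stretch
  positivity

theorem hasDerivAt_position {u : ℝ} (hu : u ∈ Ioo (-rootMax) rootMax) :
    HasDerivAt position (stretch u) u := by
  have h1 := hasDerivAt_signedRoot (neg_one_lt_position hu).le
  have hP := Real.sqrt_pos.mpr (energyFactor_pos (neg_one_lt_position hu).le)
  have hk := forceFactor_pos (neg_one_lt_position hu)
  have h2 := h1.of_local_left_inverse (continuousAt_position hu) (by positivity)
    (by filter_upwards [Ioo_mem_nhds hu.1 hu.2] with v hv using signedRoot_position hv)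
  refine h2.congr_deriv ?_
  rw [inv_div, stretch]

theorem HasDerivAt.comp_position {R : ℝ → ℝ} {R' u : ℝ} (hu : u ∈ Ioo (-rootMax) rootMax)
    (hR : HasDerivAt R R' (position u)) :
    HasDerivAt (fun u => R (position u)) (R' * stretch u) u :=
  hR.comp u (hasDerivAt_position hu)

/-- This expresses `u d/du` as `(2 x P / k) d/dx`, a rational operator free of square roots. -/
theorem mul_stretch {u : ℝ} (hu : u ∈ Ioo (-rootMax) rootMax) :
    u * stretch u =
      2 * position u * energyFactor (position u) / forceFactor (position u) := by
  have h := signedRoot_position hu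
  have hsq := Real.sq_sqrt (energyFactor_pos (neg_one_lt_position hu).le).le
  have e : u * stretch u = signedRoot (position u) * stretch u := by rw [h]
  rw [e, stretch, signedRoot]
  rw [← mul_div_assoc]
  congr 1
  linear_combination 2 * position u * hsq

/-- The second derivative of `position`, as a function of the position. -/
def periodDeriv₀ (x : ℝ) : ℝ := periodDerivNum₀ x / forceFactor x ^ 3

/-- The Euler derivative of `periodDeriv₀`. -/
def periodDeriv₁ (x : ℝ) : ℝ := periodDerivNum₁ x / forceFactor x ^ 5

/-- The second Euler derivative of `periodDeriv₀`. -/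
def periodDeriv₂ (x : ℝ) : ℝ := periodDerivNum₂ x / forceFactor x ^ 7

theorem hasDerivAt_stretch {u : ℝ} (hu : u ∈ Ioo (-rootMax) rootMax) :
    HasDerivAt stretch (periodDeriv₀ (position u)) u := by
  have hP := energyFactor_pos (neg_one_lt_position hu).le
  have hs := Real.sqrt_pos.mpr hP
  have hsq := Real.sq_sqrt hP.le
  have hk := forceFactor_pos (neg_one_lt_position hu)
  have h1 := (((hasDerivAt_energyFactor (position u)).sqrt hP.ne').const_mul 2).div
    (hasDerivAt_forceFactor (position u)) hk.ne'
  refine (h1.comp_position hu).congr_deriv ?_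
  rw [periodDeriv₀, stretch]
  generalize position u = x at *
  -- Differentiating `2 √P / k` along `x' = 2 √P / k` gives `x'' = 2 (P' k - 2 P k') / k³`.
  have e : periodDerivNum₀ x =
      2 * ((3 * x ^ 2 / 5 - 1 / 6) * forceFactor x -
        2 * energyFactor x * forceFactorDeriv x) := by
    unfold periodDerivNum₀ energyFactor forceFactor forceFactorDeriv
    ring
  rw [e]
  field_simp
  rw [hsq]
  ring

/-- The derivative of `periodDeriv₀`. -/
def periodDeriv₀Deriv (x : ℝ) : ℝ :=
  (periodDerivNum₀Deriv x * forceFactor x - 3 * periodDerivNum₀ x * forceFactorDeriv x) /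
    forceFactor x ^ 4

/-- The derivative of `periodDeriv₁`. -/
def periodDeriv₁Deriv (x : ℝ) : ℝ :=
  (periodDerivNum₁Deriv x * forceFactor x - 5 * periodDerivNum₁ x * forceFactorDeriv x) /
    forceFactor x ^ 6

theorem hasDerivAt_periodDeriv₀ {x : ℝ} (hx : -1 < x) :
    HasDerivAt periodDeriv₀ (periodDeriv₀Deriv x) x := by
  have hk := forceFactor_pos hx
  refine ((hasDerivAt_periodDerivNum₀ x).div ((hasDerivAt_forceFactor x).pow 3)
    (pow_pos hk 3).ne').congr_deriv ?_
  rw [periodDeriv₀Deriv]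
  simp only [Pi.pow_apply]
  field_simp
  norm_num
  ring

theorem hasDerivAt_periodDeriv₁ {x : ℝ} (hx : -1 < x) :
    HasDerivAt periodDeriv₁ (periodDeriv₁Deriv x) x := by
  have hk := forceFactor_pos hx
  refine ((hasDerivAt_periodDerivNum₁ x).div ((hasDerivAt_forceFactor x).pow 5)
    (pow_pos hk 5).ne').congr_deriv ?_
  rw [periodDeriv₁Deriv]
  simp only [Pi.pow_apply]
  field_simp
  norm_num
  ring

theorem continuousOn_periodDeriv₀Deriv : ContinuousOn periodDeriv₀Deriv (Ioi (-1)) := by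
  unfold periodDeriv₀Deriv
  refine ContinuousOn.div (Continuous.continuousOn ?_) (Continuous.continuousOn ?_)
    fun x hx => (pow_pos (forceFactor_pos hx) 4).ne'
  · unfold periodDerivNum₀Deriv periodDerivNum₀ forceFactor forceFactorDeriv; fun_prop
  · unfold forceFactor; fun_prop

theorem continuousOn_periodDeriv₁Deriv : ContinuousOn periodDeriv₁Deriv (Ioi (-1)) := by
  unfold periodDeriv₁Deriv
  refine ContinuousOn.div (Continuous.continuousOn ?_) (Continuous.continuousOn ?_)
    fun x hx => (pow_pos (forceFactor_pos hx) 6).ne'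
  · unfold periodDerivNum₁Deriv periodDerivNum₁ forceFactor forceFactorDeriv; fun_prop
  · unfold forceFactor; fun_prop

theorem euler_periodDeriv₀ {x : ℝ} (hx : -1 < x) :
    2 * x * energyFactor x / forceFactor x * periodDeriv₀Deriv x = periodDeriv₁ x := by
  have hk := forceFactor_pos hx
  have e : 2 * x * energyFactor x * (periodDerivNum₀Deriv x * forceFactor x -
      3 * periodDerivNum₀ x * forceFactorDeriv x) = periodDerivNum₁ x := by
    unfold periodDerivNum₀Deriv periodDerivNum₀ periodDerivNum₁ energyFactor forceFactor
      forceFactorDeriv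
    ring
  rw [periodDeriv₀Deriv, periodDeriv₁, ← e]
  field_simp

theorem euler_periodDeriv₁ {x : ℝ} (hx : -1 < x) :
    2 * x * energyFactor x / forceFactor x * periodDeriv₁Deriv x = periodDeriv₂ x := by
  have hk := forceFactor_pos hx
  have e : 2 * x * energyFactor x * (periodDerivNum₁Deriv x * forceFactor x -
      5 * periodDerivNum₁ x * forceFactorDeriv x) = periodDerivNum₂ x := by
    unfold periodDerivNum₁Deriv periodDerivNum₁ periodDerivNum₂ energyFactor forceFactor
      forceFactorDeriv
    ring
  rw [periodDeriv₁Deriv, periodDeriv₂, ← e]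
  field_simp

/-! ### Jump integrals and positivity of the Euler operator on them -/

/-- The difference of the values of `R` at the two positions of potential energy `u²`. -/
def oddJump (R : ℝ → ℝ) (u : ℝ) : ℝ := R (position u) - R (position (-u))

/-- The integral of `oddJump R` along the orbit of energy `r²`. -/
def jumpIntegral (R : ℝ → ℝ) (r : ℝ) : ℝ :=
  ∫ θ in (0 : ℝ)..Real.pi, oddJump R (r * Real.sin θ) * Real.sin θ

theorem neg_mem_Ioo_rootMax {u : ℝ} (hu : u ∈ Ioo (-rootMax) rootMax) :
    -u ∈ Ioo (-rootMax) rootMax := ⟨by linarith [hu.2], by linarith [hu.1]⟩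

theorem mul_sin_mem_Ioo_rootMax {r : ℝ} (hr : r ∈ Ioo 0 rootMax) (θ : ℝ) :
    r * Real.sin θ ∈ Ioo (-rootMax) rootMax := by
  constructor <;> nlinarith [Real.sin_le_one θ, Real.neg_one_le_sin θ, hr.1, hr.2]

theorem continuousOn_position : ContinuousOn position (Ioo (-rootMax) rootMax) :=
  fun _ hu => (continuousAt_position hu).continuousWithinAt

theorem continuousOn_stretch : ContinuousOn stretch (Ioo (-rootMax) rootMax) :=
  fun _ hu => (hasDerivAt_stretch hu).continuousAt.continuousWithinAt

theorem continuousOn_comp_position {R : ℝ → ℝ} (hR : ContinuousOn R (Ioi (-1))) :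
    ContinuousOn (fun u => R (position u)) (Ioo (-rootMax) rootMax) :=
  hR.comp continuousOn_position fun _ hu => neg_one_lt_position hu

theorem continuousOn_oddJump {R : ℝ → ℝ} (hR : ContinuousOn R (Ioi (-1))) :
    ContinuousOn (oddJump R) (Ioo (-rootMax) rootMax) :=
  (continuousOn_comp_position hR).sub
    ((continuousOn_comp_position hR).comp continuousOn_neg fun _ hu => neg_mem_Ioo_rootMax hu)

theorem continuous_oddJump_mul_sin {R : ℝ → ℝ} (hR : ContinuousOn R (Ioi (-1))) {r : ℝ}
    (hr : r ∈ Ioo 0 rootMax) :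
    Continuous fun θ => oddJump R (r * Real.sin θ) * Real.sin θ :=
  ((continuousOn_oddJump hR).comp_continuous (by fun_prop) (mul_sin_mem_Ioo_rootMax hr)).mul
    Real.continuous_sin

/-- Differentiating `jumpIntegral R` amounts to applying the Euler operator `u d/du` to `R`. -/
theorem hasDerivAt_jumpIntegral {R R' R₁ : ℝ → ℝ}
    (hR : ∀ x, -1 < x → HasDerivAt R (R' x) x) (hR' : ContinuousOn R' (Ioi (-1)))
    (hR₁ : ∀ x, -1 < x → 2 * x * energyFactor x / forceFactor x * R' x = R₁ x)
    {r : ℝ} (hr : r ∈ Ioo 0 rootMax) :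
    HasDerivAt (jumpIntegral R) (jumpIntegral R₁ r / r) r := by
  have hd : ∀ u ∈ Ioo (-rootMax) rootMax, HasDerivAt (oddJump R)
      (R' (position u) * stretch u + R' (position (-u)) * stretch (-u)) u := by
    intro u hu
    have h1 := (hR _ (neg_one_lt_position hu)).comp_position hu
    have hu' := neg_mem_Ioo_rootMax hu
    have h2 := ((hR _ (neg_one_lt_position hu')).comp_position hu').comp u (hasDerivAt_neg u)
    refine (h1.sub h2).congr_deriv ?_
    ring
  have hc : ContinuousOn (fun u => R' (position u) * stretch u) (Ioo (-rootMax) rootMax) :=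
    (continuousOn_comp_position hR').mul continuousOn_stretch
  have hc' : ContinuousOn
      (fun u => R' (position u) * stretch u + R' (position (-u)) * stretch (-u))
      (Ioo (-rootMax) rootMax) :=
    hc.add (hc.comp continuousOn_neg fun _ hu => neg_mem_Ioo_rootMax hu)
  have hr' : r ∈ Ioo (-rootMax) rootMax := ⟨by linarith [hr.1, hr.2], hr.2⟩
  refine (hasDerivAt_integral_comp_mul_sin hr' hd hc' Real.continuous_sin).congr_deriv ?_
  -- Multiplying by `r` turns `r sin θ` into `u`. The sum of the derivatives at `u` and `-u` then
  -- becomes a difference, since the Euler operator at `-u` carries the factor `-u`.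
  rw [eq_div_iff hr.1.ne', jumpIntegral, ← intervalIntegral.integral_mul_const]
  refine intervalIntegral.integral_congr fun θ _ => ?_
  have hu := mul_sin_mem_Ioo_rootMax hr θ
  have hu' := neg_mem_Ioo_rootMax hu
  have e1 := mul_stretch hu
  have e2 := mul_stretch hu'
  simp only [oddJump]
  rw [← hR₁ _ (neg_one_lt_position hu), ← hR₁ _ (neg_one_lt_position hu'), ← e1, ← e2]
  ring

theorem continuousOn_periodDeriv₀ : ContinuousOn periodDeriv₀ (Ioi (-1)) :=
  fun _ hx => (hasDerivAt_periodDeriv₀ hx).continuousAt.continuousWithinAt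

theorem continuousOn_periodDeriv₁ : ContinuousOn periodDeriv₁ (Ioi (-1)) :=
  fun _ hx => (hasDerivAt_periodDeriv₁ hx).continuousAt.continuousWithinAt

theorem continuousOn_periodDeriv₂ : ContinuousOn periodDeriv₂ (Ioi (-1)) := by
  unfold periodDeriv₂
  refine ContinuousOn.div (Continuous.continuousOn ?_) (Continuous.continuousOn ?_)
    fun x hx => (pow_pos (forceFactor_pos hx) 7).ne'
  · unfold periodDerivNum₂; fun_prop
  · unfold forceFactor; fun_prop

theorem position_pos {u : ℝ} (hu : u ∈ Ioo 0 rootMax) : 0 < position u := by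
  have h := strictMonoOn_position zero_mem_Ioo_rootMax
    ⟨by linarith [hu.1, rootMax_pos], hu.2⟩ hu.1
  rwa [position_zero] at h

theorem position_neg {u : ℝ} (hu : u ∈ Ioo 0 rootMax) : position (-u) < 0 := by
  have h := strictMonoOn_position (neg_mem_Ioo_rootMax (u := u)
    ⟨by linarith [hu.1, rootMax_pos], hu.2⟩) zero_mem_Ioo_rootMax (neg_lt_zero.mpr hu.1)
  rwa [position_zero] at h

/-- This lemma and the two after it turn comparisons of positions into comparisons of energies.
Their contrapositives locate the turning positions by evaluating `x² P(x)` at rational points. -/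
theorem le_of_le_position {u x : ℝ} (hu : u ∈ Ioo 0 rootMax) (hx : 0 ≤ x)
    (h : x ≤ position u) : x ^ 2 * energyFactor x ≤ u ^ 2 := by
  have hu' : u ∈ Ioo (-rootMax) rootMax := ⟨by linarith [hu.1, rootMax_pos], hu.2⟩
  have h1 := strictMonoOn_signedRoot.monotoneOn (show -1 ≤ x by linarith)
    (neg_one_lt_position hu').le h
  rw [signedRoot_position hu'] at h1
  rw [← signedRoot_sq (by linarith)]
  exact pow_le_pow_left₀ (mul_nonneg hx (Real.sqrt_nonneg _)) h1 2

theorem le_of_position_neg_le {u x : ℝ} (hu : u ∈ Ioo 0 rootMax) (hx : -1 ≤ x)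
    (hx0 : x ≤ 0) (h : position (-u) ≤ x) : x ^ 2 * energyFactor x ≤ u ^ 2 := by
  have hu' : -u ∈ Ioo (-rootMax) rootMax :=
    neg_mem_Ioo_rootMax ⟨by linarith [hu.1, rootMax_pos], hu.2⟩
  have h1 := strictMonoOn_signedRoot.monotoneOn (neg_one_lt_position hu').le hx h
  rw [signedRoot_position hu'] at h1
  have h2 : signedRoot x ≤ 0 := mul_nonpos_of_nonpos_of_nonneg hx0 (Real.sqrt_nonneg _)
  rw [← signedRoot_sq hx]
  nlinarith

theorem le_of_le_position_neg {u x : ℝ} (hu : u ∈ Ioo 0 rootMax) (hx : -1 ≤ x)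
    (h : x ≤ position (-u)) : u ^ 2 ≤ x ^ 2 * energyFactor x := by
  have hu' : -u ∈ Ioo (-rootMax) rootMax :=
    neg_mem_Ioo_rootMax ⟨by linarith [hu.1, rootMax_pos], hu.2⟩
  have h1 := strictMonoOn_signedRoot.monotoneOn hx (neg_one_lt_position hu').le h
  rw [signedRoot_position hu'] at h1
  rw [← signedRoot_sq hx]
  nlinarith [hu.1]

/-- The operator `(D - 2)(D - 5/2)` applied to `periodDeriv₀`. -/
def periodOp (x : ℝ) : ℝ := periodDeriv₂ x - 9 / 2 * periodDeriv₁ x + 5 * periodDeriv₀ x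

theorem periodOp_eq {x : ℝ} (hx : -1 < x) :
    periodOp x = (periodDerivNum₂ x - 9 / 2 * (periodDerivNum₁ x * forceFactor x ^ 2) +
      5 * (periodDerivNum₀ x * forceFactor x ^ 4)) / forceFactor x ^ 7 := by
  have hk := forceFactor_pos hx
  unfold periodOp periodDeriv₂ periodDeriv₁ periodDeriv₀
  field_simp

theorem oddJump_periodOp_pos {u : ℝ} (hu : u ∈ Ioo 0 rootMax) : 0 < oddJump periodOp u := by
  have hu₁ : u ∈ Ioo (-rootMax) rootMax := ⟨by linarith [hu.1, rootMax_pos], hu.2⟩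
  have hu₂ := neg_mem_Ioo_rootMax hu₁
  have hB := position_pos hu
  have hB1 := (position_mem hu₁).2
  have hA := position_neg hu
  have hA1 := neg_one_lt_position hu₂
  have eA := position_sq_mul hu₂
  have eB := position_sq_mul hu₁
  have kA := pow_pos (forceFactor_pos hA1) 7
  have kB := pow_pos (forceFactor_pos (neg_one_lt_position hu₁)) 7
  rw [oddJump, periodOp_eq hA1, periodOp_eq (neg_one_lt_position hu₁), sub_pos]
  -- The separating value is `40/3` when the right position is at most `3/5`, and `126 - 1500 u²`
  -- otherwise.
  by_cases hc : position u ≤ 3 / 5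
  · refine lt_trans (b := 40 / 3) ?_ ?_
    · rw [div_lt_iff₀ kA]
      linarith [opNum_lt_of_neg hA1 hA]
    · rw [lt_div_iff₀ kB]
      rcases le_total (position u) (3 / 10) with h | h
      · linarith [lt_opNum_of_pos_left hB h]
      · rcases h.eq_or_lt with h | h
        · linarith [lt_opNum_of_pos_left hB h.ge]
        · linarith [lt_opNum_of_pos_right h hc]
  · rw [not_le] at hc
    have hA2 : position (-u) < -(47 / 100) := by
      by_contra h
      have h1 := le_of_le_position_neg hu (by norm_num) (not_lt.mp h)
      have h2 := le_of_le_position hu (by norm_num) hc.le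
      norm_num [energyFactor] at h1 h2
      linarith
    refine lt_trans (b := 126 - 1500 * u ^ 2) ?_ ?_
    · rw [div_lt_iff₀ kA]
      rw [neg_sq] at eA
      rw [← eA]
      rcases le_or_gt (position (-u)) (-7 / 10) with h | h
      · linarith [opNum_lt_linear_left hA1 h]
      · linarith [opNum_lt_linear_right h (by linarith)]
    · rw [lt_div_iff₀ kB, ← eB]
      linarith [linear_lt_opNum hc hB1]

theorem jumpIntegral_op_pos {r : ℝ} (hr : r ∈ Ioo 0 rootMax) :
    0 < jumpIntegral periodDeriv₂ r - 9 / 2 * jumpIntegral periodDeriv₁ r +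
      5 * jumpIntegral periodDeriv₀ r := by
  have c0 := (continuous_oddJump_mul_sin continuousOn_periodDeriv₀ hr).intervalIntegrable
    (μ := volume) 0 Real.pi
  have c1 := (continuous_oddJump_mul_sin continuousOn_periodDeriv₁ hr).intervalIntegrable
    (μ := volume) 0 Real.pi
  have c2 := (continuous_oddJump_mul_sin continuousOn_periodDeriv₂ hr).intervalIntegrable
    (μ := volume) 0 Real.pi
  unfold jumpIntegral
  rw [← intervalIntegral.integral_const_mul, ← intervalIntegral.integral_const_mul,
    ← intervalIntegral.integral_sub c2 (c1.const_mul _),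
    ← intervalIntegral.integral_add (c2.sub (c1.const_mul _)) (c0.const_mul _)]
  refine intervalIntegral.intervalIntegral_pos_of_pos_on
    ((c2.sub (c1.const_mul _)).add (c0.const_mul _)) (fun θ hθ => ?_) Real.pi_pos
  have hs := Real.sin_pos_of_mem_Ioo hθ
  have h := mul_pos (oddJump_periodOp_pos (u := r * Real.sin θ)
    ⟨mul_pos hr.1 hs, (mul_sin_mem_Ioo_rootMax hr θ).2⟩) hs
  simp only [oddJump, periodOp] at h ⊢
  linarith

/-! ### Signs of the jump integral at three radii -/

theorem integral_sin_pow_five_zero_pi : ∫ θ in (0 : ℝ)..Real.pi, Real.sin θ ^ 5 = 16 / 15 := by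
  have h := integral_sin_pow_odd 2
  norm_num [Finset.prod_range_succ] at h
  exact h

theorem rootMax_gt : 9 / 20 < rootMax := by
  rw [rootMax]
  exact Real.lt_sqrt_of_sq_lt (by norm_num)

theorem periodDeriv₀_lt_of_neg {x : ℝ} (h₁ : -1 < x) (h₂ : x < 0) :
    periodDeriv₀ x < 8 / 3 - 420 * (x ^ 2 * energyFactor x) ^ 2 := by
  rw [periodDeriv₀, div_lt_iff₀ (pow_pos (forceFactor_pos h₁) 3)]
  rcases le_or_gt x (-1 / 2) with h | h
  · linarith [num_lt_quadratic_left h₁ h]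
  · linarith [num_lt_quadratic_right h h₂]

theorem neg_six_lt_periodDeriv₀ {x : ℝ} (h₁ : 0 < x) (h₂ : x < 1) : -6 < periodDeriv₀ x := by
  rw [periodDeriv₀, lt_div_iff₀ (pow_pos (forceFactor_pos (by linarith)) 3)]
  rcases le_or_gt x (1 / 2) with h | h
  · linarith [neg_six_lt_num_left h₁ h]
  · rcases le_or_gt x (3 / 4) with h' | h'
    · linarith [neg_six_lt_num_mid h h']
    · linarith [neg_six_lt_num_right h' h₂]

theorem periodDeriv₀_lt_affine {x : ℝ} (h₁ : 0 < x) (h₂ : x < 337 / 500) :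
    periodDeriv₀ x < 9 / 2 - 108 * (x ^ 2 * energyFactor x) := by
  rw [periodDeriv₀, div_lt_iff₀ (pow_pos (forceFactor_pos (by linarith)) 3)]
  rcases le_or_gt x (337 / 1000) with h | h
  · linarith [num_lt_affine_left h₁ h]
  · linarith [num_lt_affine_right h h₂]

theorem affine_lt_periodDeriv₀ {x : ℝ} (h₁ : -541 / 1000 < x) (h₂ : x < 0) :
    3 / 2 - 44 * (x ^ 2 * energyFactor x) < periodDeriv₀ x := by
  rw [periodDeriv₀, lt_div_iff₀ (pow_pos (forceFactor_pos (by linarith)) 3)]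
  linarith [affine_lt_num h₁ h₂]

theorem lt_periodDeriv₀_of_pos {x : ℝ} (h₁ : 0 < x) (h₂ : x < 1 / 5) :
    8 / 3 < periodDeriv₀ x := by
  rw [periodDeriv₀, lt_div_iff₀ (pow_pos (forceFactor_pos (by linarith)) 3)]
  linarith [lt_num_of_pos h₁ h₂]

/-- At this energy the right position stays below `1/5`, where `x''` exceeds `8/3 = x''(0)`, while
on the left `x''` is below `8/3`; so the integrand itself is positive. -/
theorem jumpIntegral_pos_of_small : 0 < jumpIntegral periodDeriv₀ (1 / 100) := by
  have hr : (1 / 100 : ℝ) ∈ Ioo 0 rootMax := ⟨by norm_num, by linarith [rootMax_gt]⟩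
  refine intervalIntegral.intervalIntegral_pos_of_pos_on
    ((continuous_oddJump_mul_sin continuousOn_periodDeriv₀ hr).intervalIntegrable _ _)
    (fun θ hθ => mul_pos ?_ (Real.sin_pos_of_mem_Ioo hθ)) Real.pi_pos
  have hs := Real.sin_pos_of_mem_Ioo hθ
  have hs1 := Real.sin_le_one θ
  have hu : 1 / 100 * Real.sin θ ∈ Ioo 0 rootMax :=
    ⟨by positivity, (mul_sin_mem_Ioo_rootMax hr θ).2⟩
  have hu1 : 1 / 100 * Real.sin θ ≤ 1 / 100 := by linarith
  generalize 1 / 100 * Real.sin θ = u at *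
  have hu₁ : u ∈ Ioo (-rootMax) rootMax := ⟨by linarith [hu.1, rootMax_pos], hu.2⟩
  have hB : position u < 1 / 5 := by
    by_contra h
    have h2 := le_of_le_position hu (by norm_num) (not_lt.mp h)
    norm_num [energyFactor] at h2
    nlinarith [hu.1]
  have h1 := lt_periodDeriv₀_of_pos (position_pos hu) hB
  have h2 := periodDeriv₀_lt_of_neg (neg_one_lt_position (neg_mem_Ioo_rootMax hu₁))
    (position_neg hu)
  rw [oddJump]
  nlinarith [sq_nonneg (position (-u) ^ 2 * energyFactor (position (-u)))]

/-- The jump is at most `3 - 64 u²`, and `64 · 9/100 = 144/25`. The bound integrates to `6 -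
(144/25)(4/3) < 0`, although the bound itself is positive for small `sin θ`. -/
theorem jumpIntegral_neg_of_mid : jumpIntegral periodDeriv₀ (3 / 10) < 0 := by
  have hr : (3 / 10 : ℝ) ∈ Ioo 0 rootMax := ⟨by norm_num, by linarith [rootMax_gt]⟩
  have hle : jumpIntegral periodDeriv₀ (3 / 10) ≤
      ∫ θ in (0 : ℝ)..Real.pi, (3 * Real.sin θ - 144 / 25 * Real.sin θ ^ 3) := by
    refine intervalIntegral.integral_mono_on Real.pi_pos.le
      ((continuous_oddJump_mul_sin continuousOn_periodDeriv₀ hr).intervalIntegrable _ _)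
      ((by fun_prop : Continuous _).intervalIntegrable _ _) fun θ hθ => ?_
    rcases (Real.sin_nonneg_of_mem_Icc hθ).eq_or_lt with hs | hs
    · rw [← hs]; simp
    have hs1 := Real.sin_le_one θ
    have hu : 3 / 10 * Real.sin θ ∈ Ioo 0 rootMax :=
      ⟨by positivity, (mul_sin_mem_Ioo_rootMax hr θ).2⟩
    have hu₁ : 3 / 10 * Real.sin θ ∈ Ioo (-rootMax) rootMax :=
      mul_sin_mem_Ioo_rootMax hr θ
    have hsq : (3 / 10 * Real.sin θ) ^ 2 ≤ 9 / 100 := by nlinarith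
    have hB : position (3 / 10 * Real.sin θ) < 337 / 500 := by
      by_contra h
      have h2 := le_of_le_position hu (by norm_num) (not_lt.mp h)
      norm_num [energyFactor] at h2
      linarith
    have hA : -541 / 1000 < position (-(3 / 10 * Real.sin θ)) := by
      by_contra h
      have h2 := le_of_position_neg_le hu (by norm_num) (by norm_num) (not_lt.mp h)
      norm_num [energyFactor] at h2
      linarith
    have h1 := periodDeriv₀_lt_affine (position_pos hu) hB
    have h2 := affine_lt_periodDeriv₀ hA (position_neg hu)
    rw [position_sq_mul hu₁] at h1
    rw [position_sq_mul (neg_mem_Ioo_rootMax hu₁)] at h2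
    have h3 : oddJump periodDeriv₀ (3 / 10 * Real.sin θ) ≤ 3 - 144 / 25 * Real.sin θ ^ 2 := by
      rw [oddJump]
      linarith
    have h4 := mul_le_mul_of_nonneg_right h3 hs.le
    linarith
  refine hle.trans_lt ?_
  rw [intervalIntegral.integral_sub ((by fun_prop : Continuous _).intervalIntegrable _ _)
    ((by fun_prop : Continuous _).intervalIntegrable _ _), intervalIntegral.integral_const_mul,
    intervalIntegral.integral_const_mul, integral_sin_pow_three, integral_sin]
  norm_num

/-- The jump is at least `420 u⁴ - 6 - 8/3`, and the integral `420 (9/20)⁴ (16/15) - 52/3` of the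
bound is positive. -/
theorem jumpIntegral_pos_of_large : 0 < jumpIntegral periodDeriv₀ (9 / 20) := by
  have hr : (9 / 20 : ℝ) ∈ Ioo 0 rootMax := ⟨by norm_num, rootMax_gt⟩
  have hle : ∫ θ in (0 : ℝ)..Real.pi,
      (420 * (9 / 20) ^ 4 * Real.sin θ ^ 5 - 26 / 3 * Real.sin θ) ≤
      jumpIntegral periodDeriv₀ (9 / 20) := by
    refine intervalIntegral.integral_mono_on Real.pi_pos.le
      ((by fun_prop : Continuous _).intervalIntegrable _ _)
      ((continuous_oddJump_mul_sin continuousOn_periodDeriv₀ hr).intervalIntegrable _ _)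
      fun θ hθ => ?_
    rcases (Real.sin_nonneg_of_mem_Icc hθ).eq_or_lt with hs | hs
    · rw [← hs]; simp
    have hu : 9 / 20 * Real.sin θ ∈ Ioo 0 rootMax :=
      ⟨by positivity, (mul_sin_mem_Ioo_rootMax hr θ).2⟩
    have hu₁ : 9 / 20 * Real.sin θ ∈ Ioo (-rootMax) rootMax :=
      mul_sin_mem_Ioo_rootMax hr θ
    have h1 := neg_six_lt_periodDeriv₀ (position_pos hu) (position_mem hu₁).2
    have h2 := periodDeriv₀_lt_of_neg (neg_one_lt_position (neg_mem_Ioo_rootMax hu₁))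
      (position_neg hu)
    rw [position_sq_mul (neg_mem_Ioo_rootMax hu₁)] at h2
    have h3 : 420 * (9 / 20) ^ 4 * Real.sin θ ^ 4 - 26 / 3 ≤
        oddJump periodDeriv₀ (9 / 20 * Real.sin θ) := by
      rw [oddJump]
      linarith
    have h4 := mul_le_mul_of_nonneg_right h3 hs.le
    linarith
  refine lt_of_lt_of_le ?_ hle
  rw [intervalIntegral.integral_sub ((by fun_prop : Continuous _).intervalIntegrable _ _)
    ((by fun_prop : Continuous _).intervalIntegrable _ _), intervalIntegral.integral_const_mul,
    intervalIntegral.integral_const_mul, integral_sin_pow_five_zero_pi, integral_sin]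
  norm_num

/-! ### The period integral and the zeros of its derivative -/

/-- The period of the orbit of energy `r²`. -/
def rootPeriod (r : ℝ) : ℝ :=
  (∫ θ in (0 : ℝ)..Real.pi, (stretch (r * Real.sin θ) + stretch (-(r * Real.sin θ)))) / √2

theorem hasDerivAt_rootPeriod {r : ℝ} (hr : r ∈ Ioo 0 rootMax) :
    HasDerivAt rootPeriod (jumpIntegral periodDeriv₀ r / √2) r := by
  have hd : ∀ u ∈ Ioo (-rootMax) rootMax, HasDerivAt (fun u => stretch u + stretch (-u))
      (oddJump periodDeriv₀ u) u := by
    intro u hu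
    have h := (hasDerivAt_stretch hu).add
      ((hasDerivAt_stretch (neg_mem_Ioo_rootMax hu)).comp u (hasDerivAt_neg u))
    refine h.congr_deriv ?_
    rw [oddJump]
    ring
  have hr' : r ∈ Ioo (-rootMax) rootMax := ⟨by linarith [hr.1, hr.2], hr.2⟩
  have h := (hasDerivAt_integral_comp_mul_sin hr' hd
    (continuousOn_oddJump continuousOn_periodDeriv₀) (continuous_const (y := (1 : ℝ)))).div_const
    (√2)
  simp only [mul_one] at h
  exact h

theorem exists_two_sign_changes_jumpIntegral :
    ∃ r₁ r₂, 0 < r₁ ∧ r₁ < r₂ ∧ r₂ < rootMax ∧ jumpIntegral periodDeriv₀ r₁ = 0 ∧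
      jumpIntegral periodDeriv₀ r₂ = 0 ∧ (∀ r ∈ Ioo 0 r₁, 0 < jumpIntegral periodDeriv₀ r) ∧
      (∀ r ∈ Ioo r₁ r₂, jumpIntegral periodDeriv₀ r < 0) ∧
      ∀ r ∈ Ioo r₂ rootMax, 0 < jumpIntegral periodDeriv₀ r :=
  exists_two_sign_changes
    (fun _ hr => hasDerivAt_jumpIntegral (fun _ hx => hasDerivAt_periodDeriv₀ hx)
      continuousOn_periodDeriv₀Deriv (fun _ hx => euler_periodDeriv₀ hx) hr)
    (fun _ hr => hasDerivAt_jumpIntegral (fun _ hx => hasDerivAt_periodDeriv₁ hx)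
      continuousOn_periodDeriv₁Deriv (fun _ hx => euler_periodDeriv₁ hx) hr)
    (fun _ hr => jumpIntegral_op_pos hr) (by norm_num) (by norm_num) (by norm_num) rootMax_gt
    jumpIntegral_pos_of_small jumpIntegral_neg_of_mid jumpIntegral_pos_of_large

/-! ### Uniqueness of solutions, and the orbits parametrised by their phase -/

/-- Global solutions of a `C¹` planar field are determined by one of their values. -/
theorem IsSolution.eq_of_eq {X : ℝ × ℝ → ℝ × ℝ} (hX : ContDiff ℝ 1 X) {γ δ : ℝ → ℝ × ℝ}
    (hγ : IsSolution X γ) (hδ : IsSolution X δ) {t₀ : ℝ} (h : γ t₀ = δ t₀) : γ = δ := by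
  have hγc : Continuous γ := continuous_iff_continuousAt.mpr fun t => (hγ t).continuousAt
  have hδc : Continuous δ := continuous_iff_continuousAt.mpr fun t => (hδ t).continuousAt
  funext t
  set a := min t t₀ - 1
  set b := max t t₀ + 1
  have hat : t ∈ Ioo a b := ⟨by linarith [min_le_left t t₀], by linarith [le_max_left t t₀]⟩
  have hat₀ : t₀ ∈ Ioo a b := ⟨by linarith [min_le_right t t₀], by linarith [le_max_right t t₀]⟩
  -- A ball containing both trajectories over a bounded time interval is compact and convex, so the
  -- field is Lipschitz on it.
  obtain ⟨R, hR⟩ := ((isCompact_Icc (a := a) (b := b)).image hγc).union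
    ((isCompact_Icc (a := a) (b := b)).image hδc) |>.isBounded.subset_closedBall 0
  obtain ⟨K, hK⟩ := (hX.contDiffOn (s := Metric.closedBall 0 R)).exists_lipschitzOnWith
    one_ne_zero (convex_closedBall _ _) (isCompact_closedBall _ _)
  exact ODE_solution_unique_of_mem_Ioo (v := fun _ => X) (s := fun _ => Metric.closedBall 0 R)
    (fun _ _ => hK) hat₀
    (fun s hs => ⟨hγ s, hR (Or.inl (mem_image_of_mem γ (Ioo_subset_Icc_self hs)))⟩)
    (fun s hs => ⟨hδ s, hR (Or.inr (mem_image_of_mem δ (Ioo_subset_Icc_self hs)))⟩) h hat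

theorem IsSolution.comp_add_const {X : ℝ × ℝ → ℝ × ℝ} {γ : ℝ → ℝ × ℝ} (hγ : IsSolution X γ)
    (c : ℝ) : IsSolution X fun t => γ (t + c) :=
  fun t => (hγ (t + c)).comp_add_const t c

/-- The time needed to reach the phase `τ` along the orbit of energy `r²`. -/
def orbitTime (r τ : ℝ) : ℝ := (∫ s in (0 : ℝ)..τ, stretch (r * Real.sin s)) / √2

/-- The phase at time `t` along the orbit of energy `r²`. -/
def orbitPhase (r : ℝ) : ℝ → ℝ := Function.invFun (orbitTime r)

/-- The orbit of energy `r²`. -/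
def orbit (r t : ℝ) : ℝ × ℝ :=
  (position (r * Real.sin (orbitPhase r t)), -(√2 * (r * Real.cos (orbitPhase r t))))

section Orbit

variable {r : ℝ}

theorem continuous_stretch_mul_sin (hr : r ∈ Ioo 0 rootMax) :
    Continuous fun s => stretch (r * Real.sin s) :=
  continuousOn_stretch.comp_continuous (by fun_prop) (mul_sin_mem_Ioo_rootMax hr)

theorem hasDerivAt_orbitTime (hr : r ∈ Ioo 0 rootMax) (τ : ℝ) :
    HasDerivAt (orbitTime r) (stretch (r * Real.sin τ) / √2) τ :=
  ((continuous_stretch_mul_sin hr).integral_hasStrictDerivAt 0 τ).hasDerivAt.div_const _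

theorem continuous_orbitTime (hr : r ∈ Ioo 0 rootMax) : Continuous (orbitTime r) :=
  continuous_iff_continuousAt.mpr fun τ => (hasDerivAt_orbitTime hr τ).continuousAt

theorem strictMono_orbitTime (hr : r ∈ Ioo 0 rootMax) : StrictMono (orbitTime r) := by
  refine strictMono_of_deriv_pos fun τ => ?_
  rw [(hasDerivAt_orbitTime hr τ).deriv]
  have := stretch_pos (mul_sin_mem_Ioo_rootMax hr τ)
  positivity

theorem periodic_stretch_mul_sin (r : ℝ) :
    Function.Periodic (fun s => stretch (r * Real.sin s)) (2 * Real.pi) := fun s => by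
  simp only [Real.sin_add_two_pi]

/-- The integrand is positive and periodic, so its integral diverges in both directions. -/
theorem surjective_orbitTime (hr : r ∈ Ioo 0 rootMax) : Function.Surjective (orbitTime r) := by
  have hint : ∀ a b, IntervalIntegrable (fun s => stretch (r * Real.sin s)) volume a b :=
    fun a b => (continuous_stretch_mul_sin hr).intervalIntegrable a b
  have hpos : ∀ s, 0 < stretch (r * Real.sin s) :=
    fun s => stretch_pos (mul_sin_mem_Ioo_rootMax hr s)
  refine (continuous_orbitTime hr).surjective ?_ ?_
  · exact ((periodic_stretch_mul_sin r).tendsto_atTop_intervalIntegral_of_pos' (hint _ _) hpos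
      Real.two_pi_pos).atTop_div_const (by positivity)
  · exact ((periodic_stretch_mul_sin r).tendsto_atBot_intervalIntegral_of_pos' (hint _ _) hpos
      Real.two_pi_pos).atBot_div_const (by positivity)

theorem orbitTime_orbitPhase (hr : r ∈ Ioo 0 rootMax) (t : ℝ) :
    orbitTime r (orbitPhase r t) = t :=
  Function.rightInverse_invFun (surjective_orbitTime hr) t

theorem orbitPhase_orbitTime (hr : r ∈ Ioo 0 rootMax) (τ : ℝ) :
    orbitPhase r (orbitTime r τ) = τ :=
  Function.leftInverse_invFun (strictMono_orbitTime hr).injective τ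

theorem orbitTime_two_pi (hr : r ∈ Ioo 0 rootMax) :
    orbitTime r (2 * Real.pi) = rootPeriod r := by
  have hc := continuous_stretch_mul_sin hr
  have hc' : Continuous fun s => stretch (-(r * Real.sin s)) :=
    continuousOn_stretch.comp_continuous (by fun_prop)
      fun s => neg_mem_Ioo_rootMax (mul_sin_mem_Ioo_rootMax hr s)
  rw [orbitTime, rootPeriod, intervalIntegral.integral_add (hc.intervalIntegrable _ _)
    (hc'.intervalIntegrable _ _), ← intervalIntegral.integral_add_adjacent_intervals
    (hc.intervalIntegrable 0 Real.pi) (hc.intervalIntegrable _ _)]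
  congr 2
  have h := intervalIntegral.integral_comp_add_right (a := 0) (b := Real.pi)
    (fun s => stretch (r * Real.sin s)) Real.pi
  rw [zero_add, ← two_mul] at h
  rw [← h]
  refine intervalIntegral.integral_congr fun s _ => ?_
  simp only [Real.sin_add_pi, mul_neg]

theorem orbitTime_add_two_pi (hr : r ∈ Ioo 0 rootMax) (τ : ℝ) :
    orbitTime r (τ + 2 * Real.pi) = orbitTime r τ + rootPeriod r := by
  have hc := continuous_stretch_mul_sin hr
  rw [← orbitTime_two_pi hr, orbitTime, orbitTime, orbitTime, ← add_div,
    (periodic_stretch_mul_sin r).intervalIntegral_add_eq_add 0 τ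
      (fun a b => hc.intervalIntegrable a b), zero_add]

theorem orbitTime_zero (r : ℝ) : orbitTime r 0 = 0 := by simp [orbitTime]

theorem rootPeriod_pos (hr : r ∈ Ioo 0 rootMax) : 0 < rootPeriod r := by
  rw [← orbitTime_two_pi hr, ← orbitTime_zero r]
  exact strictMono_orbitTime hr Real.two_pi_pos

theorem hasDerivAt_orbitPhase (hr : r ∈ Ioo 0 rootMax) (t : ℝ) :
    HasDerivAt (orbitPhase r) (√2 / stretch (r * Real.sin (orbitPhase r t))) t := by
  have hm : StrictMono (orbitPhase r) := by
    intro s t hst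
    rw [← (strictMono_orbitTime hr).lt_iff_lt, orbitTime_orbitPhase hr, orbitTime_orbitPhase hr]
    exact hst
  have hc : Continuous (orbitPhase r) :=
    hm.monotone.continuous_of_surjective fun τ => ⟨_, orbitPhase_orbitTime hr τ⟩
  have hpos := stretch_pos (mul_sin_mem_Ioo_rootMax hr (orbitPhase r t))
  refine ((hasDerivAt_orbitTime hr (orbitPhase r t)).of_local_left_inverse hc.continuousAt
    (by positivity) (Eventually.of_forall (orbitTime_orbitPhase hr))).congr_deriv ?_
  rw [inv_div]

theorem hyperellipticPotential_eq (x : ℝ) :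
    hyperellipticPotential (1 / 2) (-1) x = x * forceFactor x := by
  unfold hyperellipticPotential forceFactor
  ring

/-- The phase moves at speed `√2 / x'(u)`. The first equation follows from the chain rule; the
second from `x k(x) x'(u) = 2u`, the derivative of `G(x(u)) = u²`. -/
theorem isSolution_orbit (hr : r ∈ Ioo 0 rootMax) :
    IsSolution (potentialField (hyperellipticPotential (1 / 2) (-1))) (orbit r) := by
  intro t
  have hφ := hasDerivAt_orbitPhase hr t
  have hu := mul_sin_mem_Ioo_rootMax hr (orbitPhase r t)
  have h1 := (hasDerivAt_position hu).comp t (hφ.sin.const_mul r)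
  have h2 := ((hφ.cos.const_mul r).const_mul (√2)).neg
  refine (h1.prodMk h2).congr_deriv ?_
  have hpos := stretch_pos hu
  have hms := mul_stretch hu
  have hk := forceFactor_pos (neg_one_lt_position hu)
  have hP := energyFactor_pos (neg_one_lt_position hu).le
  have h2 : √2 * √2 = 2 := Real.mul_self_sqrt (by norm_num)
  rw [potentialField, hyperellipticPotential_eq]
  ext
  · simp only [orbit]
    field_simp
  · simp only [orbit]
    have e1 : position (r * Real.sin (orbitPhase r t)) *
        forceFactor (position (r * Real.sin (orbitPhase r t))) *
        stretch (r * Real.sin (orbitPhase r t)) = 2 * (r * Real.sin (orbitPhase r t)) := by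
      have hs := signedRoot_position hu
      have hsq := Real.sq_sqrt hP.le
      conv_rhs => rw [← hs]
      rw [stretch, signedRoot]
      field_simp
    have e2 : position (r * Real.sin (orbitPhase r t)) *
        forceFactor (position (r * Real.sin (orbitPhase r t))) =
        2 * (r * Real.sin (orbitPhase r t)) / stretch (r * Real.sin (orbitPhase r t)) := by
      rw [eq_div_iff hpos.ne', e1]
    rw [e2, eq_div_iff hpos.ne']
    field_simp
    linear_combination (r * Real.sin (orbitPhase r t)) * h2

theorem periodic_orbit (hr : r ∈ Ioo 0 rootMax) :
    Function.Periodic (orbit r) (rootPeriod r) := by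
  intro t
  have h : orbitPhase r (t + rootPeriod r) = orbitPhase r t + 2 * Real.pi := by
    rw [← orbitPhase_orbitTime hr (orbitPhase r t + 2 * Real.pi), orbitTime_add_two_pi hr,
      orbitTime_orbitPhase hr]
  simp only [orbit, h, Real.sin_add_two_pi, Real.cos_add_two_pi]

theorem orbitPhase_zero (hr : r ∈ Ioo 0 rootMax) : orbitPhase r 0 = 0 := by
  conv_lhs => rw [← orbitTime_zero r]
  exact orbitPhase_orbitTime hr 0

/-- The orbit starts at phase `0`, where `cos = 1`. A return needs `cos = 1` again, so the phase has
advanced by a positive multiple of `2π`. -/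
theorem isMinimalPeriod_orbit (hr : r ∈ Ioo 0 rootMax) :
    IsMinimalPeriod (orbit r) (rootPeriod r) := by
  refine ⟨⟨rootPeriod_pos hr, periodic_orbit hr⟩, ?_⟩
  rintro s ⟨hs, hper⟩
  have h := hper 0
  rw [zero_add] at h
  simp only [orbit, orbitPhase_zero hr, Real.cos_zero, mul_one, Prod.mk.injEq, neg_inj] at h
  have hcos : Real.cos (orbitPhase r s) = 1 := by
    have h2 : (√2 : ℝ) ≠ 0 := by positivity
    have h3 := mul_left_cancel₀ h2 h.2
    exact mul_left_cancel₀ hr.1.ne' (by rw [h3, mul_one])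
  obtain ⟨n, hn⟩ := (Real.cos_eq_one_iff _).mp hcos
  have hφ : 0 < orbitPhase r s := by
    rw [← (strictMono_orbitTime hr).lt_iff_lt, orbitTime_orbitPhase hr, orbitTime_zero]
    exact hs
  have hn1 : (1 : ℝ) ≤ n := by
    rw [← hn] at hφ
    have h4 : (0 : ℝ) < n := pos_of_mul_pos_left hφ Real.two_pi_pos.le
    have h5 : 0 < n := by exact_mod_cast h4
    exact_mod_cast h5
  rw [← orbitTime_two_pi hr, ← orbitTime_orbitPhase hr s]
  refine (strictMono_orbitTime hr).monotone ?_
  rw [← hn]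
  nlinarith [Real.pi_pos]

end Orbit

/-! ### The energy, the homoclinic loop and the period annulus -/

theorem hasDerivAt_energy (x : ℝ) :
    HasDerivAt (fun x => x ^ 2 * energyFactor x) (x * forceFactor x) x := by
  refine ((hasDerivAt_pow 2 x).mul (hasDerivAt_energyFactor x)).congr_deriv ?_
  unfold energyFactor forceFactor
  norm_num
  ring

theorem hamiltonian_eq (p : ℝ × ℝ) :
    hamiltonian (hyperellipticPotential (1 / 2) (-1)) p =
      p.2 ^ 2 / 2 + p.1 ^ 2 * energyFactor p.1 := by
  have h : ∫ s in (0 : ℝ)..p.1, hyperellipticPotential (1 / 2) (-1) s =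
      p.1 ^ 2 * energyFactor p.1 - 0 ^ 2 * energyFactor 0 := by
    refine intervalIntegral.integral_eq_sub_of_hasDerivAt
      (f := fun x => x ^ 2 * energyFactor x) (fun x _ => ?_) ?_
    · rw [hyperellipticPotential_eq]
      exact hasDerivAt_energy x
    · refine Continuous.intervalIntegrable ?_ _ _
      unfold hyperellipticPotential
      fun_prop
  rw [hamiltonian, h]
  ring

theorem continuous_hamiltonian :
    Continuous (hamiltonian (hyperellipticPotential (1 / 2) (-1))) := by
  have h : hamiltonian (hyperellipticPotential (1 / 2) (-1)) =
      fun p => p.2 ^ 2 / 2 + p.1 ^ 2 * energyFactor p.1 := funext hamiltonian_eq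
  rw [h]
  have := continuous_energyFactor
  fun_prop

theorem contDiff_potentialField :
    ContDiff ℝ 1 (potentialField (hyperellipticPotential (1 / 2) (-1))) := by
  unfold potentialField hyperellipticPotential
  fun_prop

theorem IsSolution.hamiltonian_eq {γ : ℝ → ℝ × ℝ}
    (hγ : IsSolution (potentialField (hyperellipticPotential (1 / 2) (-1))) γ) (s t : ℝ) :
    hamiltonian (hyperellipticPotential (1 / 2) (-1)) (γ s) =
      hamiltonian (hyperellipticPotential (1 / 2) (-1)) (γ t) := by
  have hd : ∀ t, HasDerivAt
      (fun t => (γ t).2 ^ 2 / 2 + (γ t).1 ^ 2 * energyFactor (γ t).1) 0 t := by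
    intro t
    have h1 : HasDerivAt (fun t => (γ t).1) (-(γ t).2) t := (hγ t).fst
    have h2 : HasDerivAt (fun t => (γ t).2)
        (hyperellipticPotential (1 / 2) (-1) (γ t).1) t := (hγ t).snd
    refine (((h2.pow 2).div_const 2).add
      ((hasDerivAt_energy (γ t).1).comp t h1)).congr_deriv ?_
    rw [hyperellipticPotential_eq]
    norm_num
    ring
  rw [_root_.hamiltonian_eq, _root_.hamiltonian_eq]
  exact is_const_of_deriv_eq_zero (fun t => (hd t).differentiableAt) (fun t => (hd t).deriv) s t

/-- The disc-like region bounded by the homoclinic loop. -/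
def loopInterior : Set (ℝ × ℝ) :=
  {p | -1 < p.1 ∧ hamiltonian (hyperellipticPotential (1 / 2) (-1)) p < 13 / 60}

theorem zero_mem_loopInterior : (0 : ℝ × ℝ) ∈ loopInterior := by
  constructor
  · norm_num
  · rw [hamiltonian_eq]; norm_num

theorem isOpen_loopInterior : IsOpen loopInterior :=
  (isOpen_lt continuous_const continuous_fst).inter
    (isOpen_lt continuous_hamiltonian continuous_const)

/-- The potential energy does not increase along the segment towards the origin, which makes the
loop interior star-shaped. -/
theorem energy_mul_le {x a : ℝ} (hx : -1 < x) (ha : 0 ≤ a) (ha1 : a ≤ 1) :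
    (a * x) ^ 2 * energyFactor (a * x) ≤ x ^ 2 * energyFactor x := by
  have hax : -1 ≤ a * x := by nlinarith
  rw [← signedRoot_sq hx.le, ← signedRoot_sq hax]
  rcases le_total 0 x with h | h
  · have h1 := strictMonoOn_signedRoot.monotoneOn hax hx.le (by nlinarith : a * x ≤ x)
    exact pow_le_pow_left₀ (mul_nonneg (mul_nonneg ha h) (Real.sqrt_nonneg _)) h1 2
  · have h1 := strictMonoOn_signedRoot.monotoneOn hx.le hax (by nlinarith : x ≤ a * x)
    have h2 : signedRoot (a * x) ≤ 0 :=
      mul_nonpos_of_nonpos_of_nonneg (mul_nonpos_of_nonneg_of_nonpos ha h) (Real.sqrt_nonneg _)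
    nlinarith

theorem isConnected_loopInterior : IsConnected loopInterior := by
  have h : StarConvex ℝ (0 : ℝ × ℝ) loopInterior := by
    rw [starConvex_zero_iff]
    rintro p ⟨hp1, hp2⟩ a ha ha1
    rw [hamiltonian_eq] at hp2
    refine ⟨?_, ?_⟩
    · simp only [Prod.smul_fst, smul_eq_mul]
      rcases ha1.eq_or_lt with rfl | h1
      · linarith
      · nlinarith [mul_nonneg ha (show 0 ≤ p.1 + 1 by linarith)]
    · rw [hamiltonian_eq]
      simp only [Prod.smul_fst, Prod.smul_snd, smul_eq_mul]
      have h1 := energy_mul_le hp1 ha ha1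
      have h2 : (a * p.2) ^ 2 ≤ p.2 ^ 2 := by
        rw [mul_pow]
        exact mul_le_of_le_one_left (sq_nonneg _) (pow_le_one₀ ha ha1)
      linarith
  exact (h.isPathConnected zero_mem_loopInterior).isConnected

theorem sqrt_mem_Ioo_rootMax {h : ℝ} (hh : h ∈ Ioo 0 (13 / 60)) : √h ∈ Ioo 0 rootMax :=
  ⟨Real.sqrt_pos.mpr hh.1, Real.sqrt_lt_sqrt hh.1.le hh.2⟩

theorem hamiltonian_orbit {r : ℝ} (hr : r ∈ Ioo 0 rootMax) (t : ℝ) :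
    hamiltonian (hyperellipticPotential (1 / 2) (-1)) (orbit r t) = r ^ 2 := by
  have h2 : √2 ^ 2 = (2 : ℝ) := Real.sq_sqrt (by norm_num)
  rw [hamiltonian_eq]
  simp only [orbit]
  rw [position_sq_mul (mul_sin_mem_Ioo_rootMax hr _), neg_sq, mul_pow, h2]
  linear_combination r ^ 2 * Real.sin_sq_add_cos_sq (orbitPhase r t)

theorem orbit_mem {r : ℝ} (hr : r ∈ Ioo 0 rootMax) (t : ℝ) :
    orbit r t ∈ loopInterior \ {0} := by
  refine ⟨⟨neg_one_lt_position (mul_sin_mem_Ioo_rootMax hr _), ?_⟩, fun h0 => ?_⟩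
  · rw [hamiltonian_orbit hr, ← rootMax_sq]
    exact pow_lt_pow_left₀ hr.2 hr.1.le two_ne_zero
  · have h := hamiltonian_orbit hr t
    rw [mem_singleton_iff.mp h0, hamiltonian_eq] at h
    have := pow_pos hr.1 2
    norm_num at h
    linarith

theorem hamiltonian_mem {p : ℝ × ℝ} (hp : p ∈ loopInterior \ {0}) :
    hamiltonian (hyperellipticPotential (1 / 2) (-1)) p ∈ Ioo 0 (13 / 60) := by
  obtain ⟨⟨h1, h2⟩, h0⟩ := hp
  refine ⟨?_, h2⟩
  rw [hamiltonian_eq]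
  have hP := energyFactor_pos h1.le
  by_cases hx : p.1 = 0
  · have hy : p.2 ≠ 0 := fun hy => h0 (Prod.ext hx hy)
    rw [hx, zero_pow two_ne_zero, zero_mul, add_zero]
    positivity
  · positivity

/-- Every point inside the loop lies on the orbit of its energy. -/
theorem exists_orbit_eq {p : ℝ × ℝ} (hp : p ∈ loopInterior \ {0}) :
    ∃ t, orbit (√(hamiltonian (hyperellipticPotential (1 / 2) (-1)) p)) t = p := by
  have hh := hamiltonian_mem hp
  have hr := sqrt_mem_Ioo_rootMax hh
  have hsq := Real.sq_sqrt hh.1.le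
  rw [hamiltonian_eq] at *
  set r := √(p.2 ^ 2 / 2 + p.1 ^ 2 * energyFactor p.1)
  have hx := hp.1.1
  have h2 : √2 ^ 2 = (2 : ℝ) := Real.sq_sqrt (by norm_num)
  have h2' : (√2 : ℝ) ≠ 0 := by positivity
  -- The phase of the point is the argument of `-y/√2 + i u`, whose modulus is `r`.
  set z : ℂ := ⟨-p.2 / √2, signedRoot p.1⟩ with hz
  have hnorm : ‖z‖ = r := by
    rw [Complex.norm_eq_sqrt_sq_add_sq, hz]
    simp only
    rw [signedRoot_sq hx.le, div_pow, h2, neg_sq]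
  have hc := Complex.norm_mul_cos_arg z
  have hs := Complex.norm_mul_sin_arg z
  rw [hnorm] at hc hs
  refine ⟨orbitTime r (Complex.arg z), ?_⟩
  have hmem := mul_sin_mem_Ioo_rootMax hr (Complex.arg z)
  rw [hs] at hmem
  rw [orbit, orbitPhase_orbitTime hr, hc, hs]
  ext
  · exact position_signedRoot hx hmem
  · simp only [hz]
    field_simp

theorem isPeriodicOrbit_range_orbit {r : ℝ} (hr : r ∈ Ioo 0 rootMax) :
    IsPeriodicOrbit (potentialField (hyperellipticPotential (1 / 2) (-1)))
      (range (orbit r)) := by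
  refine ⟨orbit r, isSolution_orbit hr, ⟨_, rootPeriod_pos hr, periodic_orbit hr⟩,
    ⟨orbitTime r Real.pi, fun h => ?_⟩, rfl⟩
  have h' := congrArg Prod.snd h
  simp only [orbit, orbitPhase_orbitTime hr, orbitPhase_zero hr, Real.cos_pi, Real.cos_zero] at h'
  have : 0 < √2 * r := mul_pos (by positivity) hr.1
  linarith

theorem isPeriodicBand_loopInterior :
    IsPeriodicBand (potentialField (hyperellipticPotential (1 / 2) (-1))) 0
      (loopInterior \ {0}) := by
  have hins : insert 0 (loopInterior \ {0}) = loopInterior := by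
    rw [insert_sdiff_singleton, insert_eq_of_mem zero_mem_loopInterior]
  refine ⟨fun h => h.2 rfl, ?_, ?_, fun q hq => ?_⟩
  · rw [hins]; exact isOpen_loopInterior
  · rw [hins]; exact isConnected_loopInterior
  · have hr := sqrt_mem_Ioo_rootMax (hamiltonian_mem hq)
    exact ⟨_, isPeriodicOrbit_range_orbit hr, exists_orbit_eq hq,
      range_subset_iff.mpr fun t => orbit_mem hr t⟩

theorem eq_zero_of_energy_eq {x y : ℝ} (hx : x = -1)
    (h : y ^ 2 / 2 + x ^ 2 * energyFactor x = 13 / 60) : y = 0 := by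
  subst hx
  norm_num [energyFactor] at h
  exact h

theorem pos_of_energy_eq {x : ℝ} (hx : -1 < x) (h : x ^ 2 * energyFactor x = 13 / 60) :
    0 < x := by
  by_contra hn
  rw [not_lt] at hn
  -- The saddle is a critical point of the potential, so `-1` is a double root; the remaining cubic
  -- is negative for `x ≤ 0`.
  have e : (x + 1) ^ 2 * (x ^ 3 / 5 - 2 * x ^ 2 / 5 + 13 * x / 30 - 13 / 60) = 0 := by
    unfold energyFactor at h
    linear_combination h
  have h1 : 0 < (x + 1) ^ 2 := by
    have : 0 < x + 1 := by linarith
    positivity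
  have h2 : x ^ 3 / 5 - 2 * x ^ 2 / 5 + 13 * x / 30 - 13 / 60 < 0 := by
    have : x ^ 3 ≤ 0 := by nlinarith [sq_nonneg x]
    nlinarith [sq_nonneg x]
  exact absurd e (mul_neg_of_pos_of_neg h1 h2).ne

/-- The energy level of the saddle carries no periodic orbit in the half plane `x ≥ -1`. -/
theorem not_periodic_of_saddle_energy {γ : ℝ → ℝ × ℝ}
    (hγ : IsSolution (potentialField (hyperellipticPotential (1 / 2) (-1))) γ)
    {s : ℝ} (hs : 0 < s) (hper : Function.Periodic γ s) (hne : ∃ t, γ t ≠ γ 0) {t₀ : ℝ}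
    (h₁ : -1 ≤ (γ t₀).1)
    (h₂ : hamiltonian (hyperellipticPotential (1 / 2) (-1)) (γ t₀) = 13 / 60) : False := by
  have hE : ∀ t, (γ t).2 ^ 2 / 2 + (γ t).1 ^ 2 * energyFactor (γ t).1 = 13 / 60 := fun t => by
    rw [← hamiltonian_eq, hγ.hamiltonian_eq t t₀, h₂]
  have hx : ∀ t, HasDerivAt (fun t => (γ t).1) (-(γ t).2) t := fun t => (hγ t).fst
  have hy : ∀ t, HasDerivAt (fun t => (γ t).2)
      ((γ t).1 * forceFactor (γ t).1) t := fun t => by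
    rw [← hyperellipticPotential_eq]; exact (hγ t).snd
  have hxc : Continuous fun t => (γ t).1 :=
    continuous_iff_continuousAt.mpr fun t => (hx t).continuousAt
  -- At this energy `x = -1` forces `y = 0`, the equilibrium, and uniqueness would make the solution
  -- constant.
  have hsad : ∀ t, (γ t).1 ≠ -1 := by
    intro t ht
    have hγt : γ t = (-1, 0) := Prod.ext ht (eq_zero_of_energy_eq ht (hE t))
    have hconst : IsSolution (potentialField (hyperellipticPotential (1 / 2) (-1)))
        fun _ => (-1, 0) := fun u => by
      refine (hasDerivAt_const u _).congr_deriv ?_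
      norm_num [potentialField, hyperellipticPotential]
      rfl
    have heq := hγ.eq_of_eq contDiff_potentialField hconst (t₀ := t) hγt
    obtain ⟨u, hu⟩ := hne
    exact hu (by rw [heq])
  have hgt : ∀ t, -1 < (γ t).1 := by
    intro t
    by_contra hn
    obtain ⟨u, -, hu⟩ := intermediate_value_uIcc (a := t) (b := t₀) hxc.continuousOn
      (show (-1 : ℝ) ∈ uIcc (γ t).1 (γ t₀).1 from
        mem_uIcc.mpr (Or.inl ⟨not_lt.mp hn, h₁⟩))
    exact hsad u hu
  -- By periodicity `x` attains a global minimum. There `y = -x' = 0`, so all the energy is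
  -- potential and the minimum is positive. Then `y' = x k(x) > 0` at all times, which is
  -- incompatible with periodicity.
  obtain ⟨m, -, hm⟩ := (isCompact_Icc (a := 0) (b := s)).exists_isMinOn
    (nonempty_Icc.mpr hs.le) hxc.continuousOn
  have hmin : ∀ t, (γ m).1 ≤ (γ t).1 := by
    intro t
    obtain ⟨u, hu, hut⟩ := hper.exists_mem_Ico₀ hs t
    rw [hut]
    exact hm (Ico_subset_Icc_self hu)
  have hloc : IsLocalMin (fun t => (γ t).1) m := Eventually.of_forall hmin
  have hm0 : (γ m).2 = 0 := neg_eq_zero.mp (hloc.hasDerivAt_eq_zero (hx m))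
  have hmE := hE m
  rw [hm0] at hmE
  have hmpos := pos_of_energy_eq (hgt m) (by linarith)
  have hmono : StrictMono fun t => (γ t).2 := by
    refine strictMono_of_deriv_pos fun t => ?_
    rw [(hy t).deriv]
    exact mul_pos (hmpos.trans_le (hmin t)) (forceFactor_pos (hgt t))
  have h := hmono hs
  have h' := hper 0
  rw [zero_add] at h'
  simp only [h', lt_irrefl] at h

/-- A band together with the origin is connected, so leaving the loop interior would mean meeting
its boundary. Boundary points have the saddle energy and `x ≥ -1`, and no periodic orbit passes
through them. -/
theorem IsPeriodicBand.subset_loopInterior {U : Set (ℝ × ℝ)}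
    (hU : IsPeriodicBand (potentialField (hyperellipticPotential (1 / 2) (-1))) 0 U) :
    U ⊆ loopInterior \ {0} := by
  obtain ⟨h0, -, hconn, hfol⟩ := hU
  have hsub : insert 0 U ⊆ loopInterior := by
    refine hconn.isPreconnected.subset_of_closure_inter_subset isOpen_loopInterior
      ⟨0, mem_insert _ _, zero_mem_loopInterior⟩ ?_
    rintro p ⟨hpc, hpU⟩
    have hcl : closure loopInterior ⊆ {p : ℝ × ℝ | -1 ≤ p.1} ∩
        {p | hamiltonian (hyperellipticPotential (1 / 2) (-1)) p ≤ 13 / 60} :=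
      closure_minimal (fun q hq => ⟨hq.1.le, hq.2.le⟩)
        ((isClosed_le continuous_const continuous_fst).inter
          (isClosed_le continuous_hamiltonian continuous_const))
    obtain ⟨hp1, hp2⟩ := hcl hpc
    rcases hpU with rfl | hpU
    · exact zero_mem_loopInterior
    by_contra hpn
    obtain ⟨Γ, ⟨γ, hγ, ⟨s, hs, hper⟩, hne, rfl⟩, ⟨t, rfl⟩, -⟩ := hfol p hpU
    refine not_periodic_of_saddle_energy hγ hs hper hne (t₀ := t) hp1 ?_
    have hp2' : hamiltonian (hyperellipticPotential (1 / 2) (-1)) (γ t) ≤ 13 / 60 := hp2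
    have hp1' : -1 ≤ (γ t).1 := hp1
    -- On the line `x = -1` the energy is at least `G(-1) = 13/60`, so there too it equals the
    -- saddle energy.
    rcases hp1'.eq_or_lt with h | h
    · refine le_antisymm hp2' ?_
      rw [hamiltonian_eq, ← h]
      norm_num [energyFactor]
      positivity
    · exact le_antisymm hp2' (not_lt.mp fun hlt => hpn ⟨h, hlt⟩)
  intro p hp
  exact ⟨hsub (mem_insert_of_mem _ hp), fun h => h0 (mem_singleton_iff.mp h ▸ hp)⟩

theorem periodAnnulus_eq :
    periodAnnulus (potentialField (hyperellipticPotential (1 / 2) (-1))) 0 =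
      loopInterior \ {0} :=
  Subset.antisymm (sUnion_subset fun _ hU => IsPeriodicBand.subset_loopInterior hU)
    (subset_sUnion_of_mem isPeriodicBand_loopInterior)

/-! ### The period function and its two critical points -/

theorem isCenter_zero : IsCenter (potentialField (hyperellipticPotential (1 / 2) (-1))) 0 := by
  refine ⟨?_, _, isPeriodicBand_loopInterior⟩
  ext <;> simp [potentialField, hyperellipticPotential]

theorem isPeriodFunction_rootPeriod :
    IsPeriodFunction (hyperellipticPotential (1 / 2) (-1)) (13 / 60)
      fun h => rootPeriod (√h) := by
  rw [IsPeriodFunction, periodAnnulus_eq]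
  refine ⟨Subset.antisymm (image_subset_iff.mpr fun p hp => hamiltonian_mem hp) fun h hh => ?_,
    fun h hh => ⟨?_, ?_⟩⟩
  · have hr := sqrt_mem_Ioo_rootMax hh
    exact ⟨orbit (√h) 0, orbit_mem hr 0, by rw [hamiltonian_orbit hr, Real.sq_sqrt hh.1.le]⟩
  · have hr := sqrt_mem_Ioo_rootMax hh
    convert isPeriodicOrbit_range_orbit hr using 1
    ext q
    constructor
    · rintro ⟨hq, rfl⟩
      exact exists_orbit_eq hq
    · rintro ⟨t, rfl⟩
      exact ⟨orbit_mem hr t, by rw [hamiltonian_orbit hr, Real.sq_sqrt hh.1.le]⟩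
  · rintro γ hγ hγ0 rfl
    have hr := sqrt_mem_Ioo_rootMax hh
    obtain ⟨c, hc⟩ := exists_orbit_eq hγ0
    set r := √(hamiltonian (hyperellipticPotential (1 / 2) (-1)) (γ 0))
    -- By uniqueness every motion on the level is a time shift of `orbit r`, so it has the same
    -- periods.
    have heq : γ = fun t => orbit r (t + c) :=
      hγ.eq_of_eq contDiff_potentialField ((isSolution_orbit hr).comp_add_const c) (t₀ := 0)
        (by rw [zero_add, hc])
    have hmin := isMinimalPeriod_orbit hr
    refine ⟨⟨hmin.1.1, fun t => ?_⟩, fun s hs => hmin.2 ⟨hs.1, fun t => ?_⟩⟩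
    · rw [heq]
      simp only
      rw [add_right_comm]
      exact hmin.1.2 (t + c)
    · have h := hs.2 (t - c)
      rw [heq] at h
      simp only at h
      rwa [sub_add_cancel, show t - c + s + c = t + s by ring] at h

theorem hasDerivAt_rootPeriod_sqrt {h : ℝ} (hh : h ∈ Ioo 0 (13 / 60)) :
    HasDerivAt (fun h => rootPeriod (√h))
      (jumpIntegral periodDeriv₀ (√h) / √2 * (1 / (2 * √h))) h :=
  (hasDerivAt_rootPeriod (sqrt_mem_Ioo_rootMax hh)).comp h (Real.hasDerivAt_sqrt hh.1.ne')

theorem mainTheorem5 :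
    IsCenter (potentialField (hyperellipticPotential (1 / 2) (-1))) 0 ∧
    ∃ (hs : ℝ) (T : ℝ → ℝ), 0 < hs ∧
      IsPeriodFunction (hyperellipticPotential (1 / 2) (-1)) hs T ∧
      DifferentiableOn ℝ T (Set.Ioo 0 hs) ∧
      (criticalEnergies hs T).ncard = 2 ∧
      criticalEnergies hs T = {h | h ∈ Set.Ioo 0 hs ∧ deriv T h = 0} := by
  refine ⟨isCenter_zero, 13 / 60, fun h => rootPeriod (√h), by norm_num,
    isPeriodFunction_rootPeriod,
    fun h hh => (hasDerivAt_rootPeriod_sqrt hh).differentiableAt.differentiableWithinAt, ?_⟩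
  set T : ℝ → ℝ := fun h => rootPeriod (√h)
  have hdiff : ∀ h ∈ Ioo (0 : ℝ) (13 / 60), DifferentiableAt ℝ T h :=
    fun h hh => (hasDerivAt_rootPeriod_sqrt hh).differentiableAt
  obtain ⟨r₁, r₂, h0, h12, h2, hz₁, hz₂, hp₁, hn, hp₂⟩ := exists_two_sign_changes_jumpIntegral
  -- The change of variable `h = r²` only multiplies the derivative by a positive factor, so zeros
  -- and signs carry over from `r` to `√h`.
  have hderiv : ∀ h ∈ Ioo (0 : ℝ) (13 / 60),
      ∃ c > 0, deriv T h = c * jumpIntegral periodDeriv₀ (√h) := by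
    intro h hh
    have hr := (sqrt_mem_Ioo_rootMax hh).1
    exact ⟨1 / (√2 * (2 * √h)), by positivity, by
      rw [(hasDerivAt_rootPeriod_sqrt hh).deriv]; field_simp⟩
  have hr₂0 : 0 < r₂ := h0.trans h12
  have hlt : r₁ ^ 2 < r₂ ^ 2 := pow_lt_pow_left₀ h12 h0.le two_ne_zero
  have hlt₂ : r₂ ^ 2 < 13 / 60 := by
    rw [← rootMax_sq]; exact pow_lt_pow_left₀ h2 hr₂0.le two_ne_zero
  have hpos₁ : 0 < r₁ ^ 2 := by positivity
  have dpos : ∀ h ∈ Ioo 0 (r₁ ^ 2), 0 < deriv T h := by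
    intro h hh
    obtain ⟨c, hc, e⟩ := hderiv h ⟨hh.1, by linarith [hh.2]⟩
    rw [e]
    exact mul_pos hc (hp₁ _ ⟨Real.sqrt_pos.mpr hh.1, (Real.sqrt_lt' h0).mpr hh.2⟩)
  have dneg : ∀ h ∈ Ioo (r₁ ^ 2) (r₂ ^ 2), deriv T h < 0 := by
    intro h hh
    obtain ⟨c, hc, e⟩ := hderiv h ⟨by linarith [hh.1], by linarith [hh.2]⟩
    rw [e]
    exact mul_neg_of_pos_of_neg hc
      (hn _ ⟨Real.lt_sqrt_of_sq_lt hh.1, (Real.sqrt_lt' hr₂0).mpr hh.2⟩)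
  have dpos' : ∀ h ∈ Ioo (r₂ ^ 2) (13 / 60), 0 < deriv T h := by
    intro h hh
    have hh' : h ∈ Ioo (0 : ℝ) (13 / 60) := ⟨by linarith [hh.1], hh.2⟩
    obtain ⟨c, hc, e⟩ := hderiv h hh'
    rw [e]
    exact mul_pos hc (hp₂ _ ⟨Real.lt_sqrt_of_sq_lt hh.1, (sqrt_mem_Ioo_rootMax hh').2⟩)
  have hzero : {h | h ∈ Ioo (0 : ℝ) (13 / 60) ∧ deriv T h = 0} = {r₁ ^ 2, r₂ ^ 2} := by
    ext h
    simp only [mem_ofPred_eq, mem_insert_iff, mem_singleton_iff]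
    constructor
    · rintro ⟨hh, hd⟩
      by_contra hne
      rw [not_or] at hne
      rcases lt_or_gt_of_ne hne.1 with h1 | h1
      · exact (dpos h ⟨hh.1, h1⟩).ne' hd
      · rcases lt_or_gt_of_ne hne.2 with h3 | h3
        · exact (dneg h ⟨h1, h3⟩).ne hd
        · exact (dpos' h ⟨h3, hh.2⟩).ne' hd
    · rintro (rfl | rfl)
      · have hh : r₁ ^ 2 ∈ Ioo (0 : ℝ) (13 / 60) := ⟨hpos₁, by linarith⟩
        obtain ⟨c, -, e⟩ := hderiv _ hh
        exact ⟨hh, by rw [e, Real.sqrt_sq h0.le, hz₁, mul_zero]⟩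
      · have hh : r₂ ^ 2 ∈ Ioo (0 : ℝ) (13 / 60) := ⟨by linarith, hlt₂⟩
        obtain ⟨c, -, e⟩ := hderiv _ hh
        exact ⟨hh, by rw [e, Real.sqrt_sq hr₂0.le, hz₂, mul_zero]⟩
  have hd : ∀ {a b : ℝ}, 0 ≤ a → b ≤ 13 / 60 → DifferentiableOn ℝ T (Ioo a b) :=
    fun ha hb h hh =>
      (hdiff h ⟨ha.trans_lt hh.1, hh.2.trans_le hb⟩).differentiableWithinAt
  have hmax : IsLocalMax T (r₁ ^ 2) :=
    isLocalMax_of_deriv_Ioo hpos₁ hlt (hdiff _ ⟨hpos₁, by linarith⟩).continuousAt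
      (hd le_rfl (by linarith)) (hd hpos₁.le hlt₂.le) (fun h hh => (dpos h hh).le)
      fun h hh => (dneg h hh).le
  have hmin : IsLocalMin T (r₂ ^ 2) :=
    isLocalMin_of_deriv_Ioo hlt hlt₂ (hdiff _ ⟨by linarith, hlt₂⟩).continuousAt
      (hd hpos₁.le hlt₂.le) (hd (by linarith) le_rfl) (fun h hh => (dneg h hh).le)
      fun h hh => (dpos' h hh).le
  have hcrit : criticalEnergies (13 / 60) T =
      {h | h ∈ Ioo (0 : ℝ) (13 / 60) ∧ deriv T h = 0} := by
    refine Subset.antisymm (fun h hh => ⟨hh.1, hh.2.deriv_eq_zero⟩) fun h hh => ⟨hh.1, ?_⟩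
    rw [hzero] at hh
    rcases hh with rfl | hh
    · exact Or.inr hmax
    · rw [mem_singleton_iff.mp hh]
      exact Or.inl hmin
  refine ⟨?_, hcrit⟩
  rw [hcrit, hzero]
  exact ncard_pair hlt.ne

end
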